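/- Let $d\ge 4$, $G_d>0$, and let $S_{d-2}=2\pi^{(d-1)/2}/\Gamma((d-1)/2)$. Let $\Omega\subset\mathbb R^{d-1}$ be a nonempty bounded connected open set (the region enclosed by the surface of the fluid), and on $\mathbb R\times\Omega$ consider the static metric $ds^2=-W^2dt^2+h_{ij}dx^idx^j$, where $W>0$, $h$ is positive definite, and $W$, $h_{ij}$, the electric potential $\phi$, the matter density $\rho_m$, the pressure $p$ and the charge density $\rho_e$ are smooth functions on $\Omega$ of the spatial coordinates alone (no singularities). Suppose that everywhere in $\mathbb R\times\Omega$ (no holes or alien matter) the Einstein–Maxwell equations of a charged pressure fluid hold: $$R_{\mu\nu}-\tfrac12 g_{\mu\nu}R=\tfrac{d-2}{d-3}S_{d-2}G_d\,(T_{\mu\nu}+E_{\mu\nu}),\qquad \nabla_\nu F^{\mu\nu}=S_{d-2}J^\mu ,$$ with $F_{\mu\nu}=\nabla_\mu A_\nu-\nabla_\nu A_\mu$, $A_\mu=-\phi\,\delta^0_\mu$, $U_\mu=-W\delta^0_\mu$, $J_\mu=\rho_eU_\mu$, $T_{\mu\nu}=(\rho_m+p)U_\mu U_\nu+p\,g_{\mu\nu}$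 and $S_{d-2}E_{\mu\nu}=F_\mu{}^\rho F_{\nu\rho}-\tfrac14 g_{\mu\nu}F_{\rho\sigma}F^{\rho\sigma}$. Put $\rho_{em}=\dfrac{h^{ij}\partial_i\phi\,\partial_j\phi}{S_{d-2}W^2}$. Suppose that the boundary of $\Omega$ is equipotential, i.e. $\phi$ extends continuously to $\overline\Omega$ and is constant on $\partial\Omega$; that the fluid is of Weyl type, i.e. $W=W(\phi)$ is a $C^2$ function of $\phi$; and that $W$ is not constant on $\Omega$. A prime denotes $d/d\phi$. Let $\bar\lambda,\bar\chi$ be real constants, and consider the pressure condition: $p=p(\phi)$ is a differentiable function of $\phi$ and, on $\Omega$, $$\Big(p'-\frac{2}{d-3}\frac{W'}{W}p\Big)W=\frac{\bar\chi}{W^2}\rho_e+\bar\lambda W'\Big(\rho_m+\frac{d-1}{d-3}p+\rho_{em}\Big).\tag{P}$$ (i) If (P) holds, then $1+\bar\lambda\neq0$, and for each $\epsilon\in\{1,-1\}$ there is a constant $b$ such that on $\Omega$ $$W^2=\frac{1}{1+\bar\lambda}\big(-\epsilon\sqrt{G_d}\,\phi+b\big)^2-\bar\chi,\tag{W}$$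 $$b\rho_e=\epsilon(1+\bar\lambda)\sqrt{G_d}\Big[\Big(\rho_m+\frac{d-1}{d-3}p\Big)W+\phi\rho_e-\frac{\bar\lambda}{1+\bar\lambda}\big(\phi\rho_e-W\rho_{em}\big)\Big],\tag{C}$$ and, in equivalent form, $$\rho_e\big(-\epsilon\sqrt{G_d}\,\phi+b\big)=\epsilon(1+\bar\lambda)\sqrt{G_d}\Big(\rho_m+\frac{d-1}{d-3}p+\frac{\bar\lambda}{1+\bar\lambda}\rho_{em}\Big)W .$$ (ii) Conversely, let $1+\bar\lambda\ne0$, $\epsilon\in\{1,-1\}$ and $b\in\mathbb R$, and suppose that (C) holds on $\Omega$ (whether or not (P) does). Then $W$ has the form (W) on $\Omega$, with the given $\epsilon,b,\bar\lambda$ and with some constant in place of $\bar\chi$. If moreover (P) holds with $\bar\lambda$ and $\bar\chi$, then (W) holds with that same $\bar\chi$. -/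

import Mathlib

open scoped ContDiff

noncomputable section

namespace EMFluid

/-! Tensor calculus in one coordinate chart, with an arbitrary finite set `ι` of indices. -/

section Chart

variable {ι : Type*} [Fintype ι] [DecidableEq ι]

/-- The partial derivative of `f` in the direction of the coordinate `μ`. -/
def pd (μ : ι) (f : (ι → ℝ) → ℝ) (x : ι → ℝ) : ℝ :=
  fderiv ℝ f x (Pi.single μ 1)

/-- Christoffel symbols `Γ^a_{bc}` of the metric `g`. -/
def christoffel (g : (ι → ℝ) → Matrix ι ι ℝ) (a b c : ι) (x : ι → ℝ) : ℝ :=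
  1 / 2 * ∑ e, (g x)⁻¹ a e *
    (pd b (fun y => g y e c) x + pd c (fun y => g y e b) x - pd e (fun y => g y b c) x)

/-- Riemann tensor `R^a_{bcd} = ∂_c Γ^a_{db} - ∂_d Γ^a_{cb} + Γ^a_{ce} Γ^e_{db} - Γ^a_{de} Γ^e_{cb}`. -/
def riemann (g : (ι → ℝ) → Matrix ι ι ℝ) (a b c d : ι) (x : ι → ℝ) : ℝ :=
  pd c (christoffel g a d b) x - pd d (christoffel g a c b) x
    + ∑ e, (christoffel g a c e x * christoffel g e d b x
        - christoffel g a d e x * christoffel g e c b x)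

/-- Ricci tensor `R_{bd} = R^a_{bad}`. -/
def ricci (g : (ι → ℝ) → Matrix ι ι ℝ) (b d : ι) (x : ι → ℝ) : ℝ :=
  ∑ a, riemann g a b a d x

/-- Scalar curvature `R = g^{ab} R_{ab}`. -/
def scalarCurvature (g : (ι → ℝ) → Matrix ι ι ℝ) (x : ι → ℝ) : ℝ :=
  ∑ a, ∑ b, (g x)⁻¹ a b * ricci g a b x

/-- Einstein tensor `G_{μν} = R_{μν} - (1/2) g_{μν} R`. -/
def einsteinTensor (g : (ι → ℝ) → Matrix ι ι ℝ) (μ ν : ι) (x : ι → ℝ) : ℝ :=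
  ricci g μ ν x - 1 / 2 * g x μ ν * scalarCurvature g x

/-- Maxwell tensor `F_{μν}` of the gauge field `A_μ` (the Christoffel terms in
`∇_μ A_ν - ∇_ν A_μ` cancel). -/
def maxwellTensor (A : (ι → ℝ) → ι → ℝ) (μ ν : ι) (x : ι → ℝ) : ℝ :=
  pd μ (fun y => A y ν) x - pd ν (fun y => A y μ) x

/-- `F^{μν} = g^{μα} g^{νβ} F_{αβ}`. -/
def maxwellTensorUp (g : (ι → ℝ) → Matrix ι ι ℝ) (A : (ι → ℝ) → ι → ℝ) (μ ν : ι)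
    (x : ι → ℝ) : ℝ :=
  ∑ α, ∑ β, (g x)⁻¹ μ α * (g x)⁻¹ ν β * maxwellTensor A α β x

/-- `∇_ν F^{μν} = ∂_ν F^{μν} + Γ^μ_{νκ} F^{κν} + Γ^ν_{νκ} F^{μκ}`. -/
def maxwellDivergence (g : (ι → ℝ) → Matrix ι ι ℝ) (A : (ι → ℝ) → ι → ℝ) (μ : ι)
    (x : ι → ℝ) : ℝ :=
  ∑ ν, (pd ν (maxwellTensorUp g A μ ν) x
    + ∑ κ, (christoffel g μ ν κ x * maxwellTensorUp g A κ ν x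
        + christoffel g ν ν κ x * maxwellTensorUp g A μ κ x))

/-- Electromagnetic energy-momentum tensor,
`S E_{μν} = F_μ^ρ F_{νρ} - (1/4) g_{μν} F_{ρσ} F^{ρσ}`. -/
def emTensor (S : ℝ) (g : (ι → ℝ) → Matrix ι ι ℝ) (A : (ι → ℝ) → ι → ℝ) (μ ν : ι)
    (x : ι → ℝ) : ℝ :=
  1 / S * ((∑ ρ, ∑ σ, (g x)⁻¹ ρ σ * maxwellTensor A μ σ x * maxwellTensor A ν ρ x)
    - 1 / 4 * g x μ ν * ∑ ρ, ∑ σ, maxwellTensor A ρ σ x * maxwellTensorUp g A ρ σ x)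

end Chart

/-- The area of the unit sphere of dimension `n - 1` in `n`-dimensional Euclidean space. -/
def sphereArea (n : ℕ) : ℝ :=
  2 * Real.pi ^ ((n : ℝ) / 2) / Real.Gamma ((n : ℝ) / 2)

/-- The fields of a static charged fluid in a spacetime of dimension `d = n + 1`, as functions of
the `n` spatial coordinates: metric potential `W`, spatial metric `h`, electric potential `φ`,
matter density `ρm`, pressure `p`, charge density `ρe`. -/
structure StaticFluid (n : ℕ) where
  W : (Fin n → ℝ) → ℝ
  h : (Fin n → ℝ) → Matrix (Fin n) (Fin n) ℝ
  φ : (Fin n → ℝ) → ℝ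
  ρm : (Fin n → ℝ) → ℝ
  p : (Fin n → ℝ) → ℝ
  ρe : (Fin n → ℝ) → ℝ

namespace StaticFluid

variable {n : ℕ} (X : StaticFluid n)

/-- Spacetime coordinates: the time `x (Sum.inl 0)` and the spatial coordinates
`x (Sum.inr i)`. -/
abbrev Index (n : ℕ) : Type := Fin 1 ⊕ Fin n

/-- The spatial coordinates of a spacetime point. -/
def space (x : Index n → ℝ) : Fin n → ℝ := fun i => x (Sum.inr i)

/-- `ds² = - W² dt² + h_{ij} dx^i dx^j`. -/
def metric (x : Index n → ℝ) : Matrix (Index n) (Index n) ℝ :=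
  Matrix.fromBlocks (Matrix.of fun _ _ => -(X.W (space x)) ^ 2) 0 0 (X.h (space x))

/-- Gauge field `A_μ = - φ δ_μ^0`. -/
def gauge (x : Index n → ℝ) : Index n → ℝ :=
  Sum.elim (fun _ => -X.φ (space x)) (fun _ => 0)

/-- Fluid velocity `U_μ = - W δ_μ^0`. -/
def velocity (x : Index n → ℝ) : Index n → ℝ :=
  Sum.elim (fun _ => -X.W (space x)) (fun _ => 0)

/-- `T_{μν} = (ρ_m + p) U_μ U_ν + p g_{μν}`. -/
def fluidTensor (μ ν : Index n) (x : Index n → ℝ) : ℝ :=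
  (X.ρm (space x) + X.p (space x)) * X.velocity x μ * X.velocity x ν
    + X.p (space x) * X.metric x μ ν

/-- Current `J^μ = g^{μν} ρ_e U_ν`. -/
def current (μ : Index n) (x : Index n → ℝ) : ℝ :=
  ∑ ν, (X.metric x)⁻¹ μ ν * (X.ρe (space x) * X.velocity x ν)

/-- The fields are smooth on the spatial region `Ω`, `-W² dt² + h` is a Lorentzian metric there, and
the Einstein-Maxwell equations with gravitational constant `G` hold at all points over `Ω`.
With `d = n + 1` one has `(d - 2) / (d - 3) = (n - 1) / (n - 2)` and `S_{d-2} = sphereArea n`. -/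
structure IsEinsteinMaxwell (G : ℝ) (Ω : Set (Fin n → ℝ)) : Prop where
  smooth_W : ContDiffOn ℝ ∞ X.W Ω
  smooth_h : ∀ i j, ContDiffOn ℝ ∞ (fun y => X.h y i j) Ω
  smooth_φ : ContDiffOn ℝ ∞ X.φ Ω
  smooth_ρm : ContDiffOn ℝ ∞ X.ρm Ω
  smooth_p : ContDiffOn ℝ ∞ X.p Ω
  smooth_ρe : ContDiffOn ℝ ∞ X.ρe Ω
  W_pos : ∀ y ∈ Ω, 0 < X.W y
  h_posDef : ∀ y ∈ Ω, (X.h y).PosDef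
  einstein : ∀ x : Index n → ℝ, space x ∈ Ω → ∀ μ ν,
    einsteinTensor X.metric μ ν x =
      ((n : ℝ) - 1) / ((n : ℝ) - 2) * sphereArea n * G *
        (X.fluidTensor μ ν x + emTensor (sphereArea n) X.metric X.gauge μ ν x)
  maxwell : ∀ x : Index n → ℝ, space x ∈ Ω → ∀ μ,
    maxwellDivergence X.metric X.gauge μ x = sphereArea n * X.current μ x

/-- Electromagnetic energy density `ρ_em = (∇_i φ)² / (S W²)`, the square being taken
with `h^{ij}`. -/
def ρem (y : Fin n → ℝ) : ℝ :=
  1 / sphereArea n *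
    ((∑ i, ∑ j, (X.h y)⁻¹ i j * pd i X.φ y * pd j X.φ y) / X.W y ^ 2)

/-- For a fluid with `W = w(φ)`: the pressure is a differentiable function `P` of `φ`, and
`(p' - (2/(d-3)) (W'/W) p) W = (χ/W²) ρ_e + lam W' (ρ_m + ((d-1)/(d-3)) p + ρ_em)` on `Ω`, where
`d = n + 1` and the prime is the derivative with respect to `φ`. -/
def PressureCondition (Ω : Set (Fin n → ℝ)) (w : ℝ → ℝ) (lam χ : ℝ) : Prop :=
  ∃ P : ℝ → ℝ, Differentiable ℝ P ∧ (∀ y ∈ Ω, X.p y = P (X.φ y)) ∧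
    ∀ y ∈ Ω,
      (deriv P (X.φ y) - 2 / ((n : ℝ) - 2) * (deriv w (X.φ y) / X.W y) * X.p y) * X.W y =
        χ / X.W y ^ 2 * X.ρe y
          + lam * deriv w (X.φ y) * (X.ρm y + (n : ℝ) / ((n : ℝ) - 2) * X.p y + X.ρem y)

/-- `W² = (-ε √G φ + b)² / (1 + lam) - χ` on `Ω`. -/
def WeylRelation (G : ℝ) (Ω : Set (Fin n → ℝ)) (lam χ ε b : ℝ) : Prop :=
  ∀ y ∈ Ω, X.W y ^ 2 = 1 / (1 + lam) * (-ε * √G * X.φ y + b) ^ 2 - χ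

/-- The constraint
`b ρ_e = ε (1+lam) √G [(ρ_m + ((d-1)/(d-3)) p) W + φ ρ_e - (lam/(1+lam)) (φ ρ_e - W ρ_em)]`
on `Ω`. -/
def FluidConstraint (G : ℝ) (Ω : Set (Fin n → ℝ)) (lam ε b : ℝ) : Prop :=
  ∀ y ∈ Ω, b * X.ρe y =
    ε * (1 + lam) * √G *
      ((X.ρm y + (n : ℝ) / ((n : ℝ) - 2) * X.p y) * X.W y + X.φ y * X.ρe y
        - lam / (1 + lam) * (X.φ y * X.ρe y - X.W y * X.ρem y))

/-- The constraint in the form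
`ρ_e (-ε √G φ + b) = ε (1+lam) √G (ρ_m + ((d-1)/(d-3)) p + (lam/(1+lam)) ρ_em) W` on `Ω`. -/
def FluidConstraint' (G : ℝ) (Ω : Set (Fin n → ℝ)) (lam ε b : ℝ) : Prop :=
  ∀ y ∈ Ω, X.ρe y * (-ε * √G * X.φ y + b) =
    ε * (1 + lam) * √G *
      (X.ρm y + (n : ℝ) / ((n : ℝ) - 2) * X.p y + lam / (1 + lam) * X.ρem y) * X.W y

end StaticFluid

end EMFluid

end

open scoped ContDiff Matrix

set_option linter.unusedSectionVars false

/-! ### Calculus of partial derivatives and of matrix-valued functions in a chart. -/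

noncomputable section

namespace EMFluid

section ChartCalculus

variable {ι : Type*} [Fintype ι] [DecidableEq ι] {s : Set (ι → ℝ)} {x : ι → ℝ}

/-! ### Partial derivatives -/

/-! Write S for the sphere area, n = d - 1, m = ρ_m + (n/(n-2)) p and B = w w', so that 2B is the
derivative of w². The field equations enter through three scalar or vector consequences: Gauss' law
div(∇φ/W) = -S ρ_e (`divergence_gradient_φ`); the time-time Einstein equation ΔW = S G W (m + ρ_em)
(`laplacian_W`); and hydrostatic equilibrium W ∇p + (ρ_m + p) ∇W + ρ_e ∇φ = 0 (`euler`), which comes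
from the contracted Bianchi identity (`mixedDivergence_einstein`). Since W = w(φ) gives ∇W = B(φ)
∇φ/W, the first two combine into B' ρ_em = w' ρ_e + G (m + ρ_em) (`weyl_equation`).

The analytic core is `eq_zero_of_divergence_free`. If a C¹ function Q satisfies W Q'(φ) ρ_em = 2
Q(φ) ρ_e, then formally div(√|Q(φ)| ∇φ/W) = 0. Multiply this field by g(φ), where g is C¹, vanishes
near the boundary value φ₀ and is nondecreasing. The product has compact support in Ω, so its
divergence integrates to zero, and what remains is the integral of the nonnegative function g' √|Q|
W ρ_em. Hence Q ∇φ = 0 wherever φ ≠ φ₀, and then everywhere by continuity. An antiderivative of Q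
composed with φ is therefore constant on the connected set Ω, and Q vanishes on the interval φ(Ω).
The square root is not C¹ at zeros of Q, so it is regularized and a limit is taken. Because the
support is compact, no regularity of the boundary is needed.

For (i), equilibrium and (P) eliminate p', and the Weyl equation eliminates m. The outcome is the
hypothesis above for Q = (1+λ) B² - G (w² + χ), so Q = 0 on φ(Ω) (`first_integral`). As W is not
constant, 1+λ ≠ 0. Differentiating Q = 0 gives B = 0 or B' = G/(1+λ) at each point; continuity of B'
and nonconstancy of W leave only the second, so B is affine. Its intercept defines b, the first
integral becomes (W), and the Weyl equation becomes (C).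

For (ii), let Y be half the derivative of w² - (-ε√G φ + b)²/(1+λ). The constraint says exactly that
W Y' ρ_em = Y ρ_e, so Q = Y² is admissible, Y = 0, and (W) holds with some constant. If (P) holds as
well, (i) supplies a second relation of the same form with the given χ, and the two values of b must
agree (`WeylRelation.const_unique`). -/

theorem pd_const (μ : ι) (c : ℝ) (x : ι → ℝ) : pd μ (fun _ => c) x = 0 := by
  simp [pd]

theorem pd_add {f g : (ι → ℝ) → ℝ} (μ : ι) (hf : DifferentiableAt ℝ f x)
    (hg : DifferentiableAt ℝ g x) : pd μ (fun y => f y + g y) x = pd μ f x + pd μ g x := by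
  simp [pd, fderiv_fun_add hf hg]

theorem pd_sub {f g : (ι → ℝ) → ℝ} (μ : ι) (hf : DifferentiableAt ℝ f x)
    (hg : DifferentiableAt ℝ g x) : pd μ (fun y => f y - g y) x = pd μ f x - pd μ g x := by
  simp [pd, fderiv_fun_sub hf hg]

theorem pd_neg (μ : ι) (f : (ι → ℝ) → ℝ) (x : ι → ℝ) :
    pd μ (fun y => -f y) x = -pd μ f x := by
  simp [pd, fderiv_fun_neg]

theorem pd_mul {f g : (ι → ℝ) → ℝ} (μ : ι) (hf : DifferentiableAt ℝ f x)
    (hg : DifferentiableAt ℝ g x) :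
    pd μ (fun y => f y * g y) x = pd μ f x * g x + f x * pd μ g x := by
  simp [pd, fderiv_fun_mul hf hg]; ring

theorem pd_sum {κ : Type*} {t : Finset κ} {f : κ → (ι → ℝ) → ℝ} (μ : ι)
    (hf : ∀ i ∈ t, DifferentiableAt ℝ (f i) x) :
    pd μ (fun y => ∑ i ∈ t, f i y) x = ∑ i ∈ t, pd μ (f i) x := by
  simp [pd, fderiv_fun_sum hf]

theorem pd_comp {f : (ι → ℝ) → ℝ} {A : ℝ → ℝ} (μ : ι) (hA : DifferentiableAt ℝ A (f x))
    (hf : DifferentiableAt ℝ f x) : pd μ (fun y => A (f y)) x = deriv A (f x) * pd μ f x := by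
  have := fderiv_comp x hA hf
  simp only [pd]
  rw [show (fun y => A (f y)) = A ∘ f from rfl, this]
  simp [mul_comm]

theorem pd_congr {f g : (ι → ℝ) → ℝ} (μ : ι) (hs : IsOpen s) (hx : x ∈ s)
    (h : ∀ y ∈ s, f y = g y) : pd μ f x = pd μ g x := by
  have : f =ᶠ[nhds x] g := by
    filter_upwards [hs.mem_nhds hx] with y hy using h y hy
  simp [pd, this.fderiv_eq]

theorem differentiableAt_of_contDiffOn {f : (ι → ℝ) → ℝ} (hs : IsOpen s) (hx : x ∈ s)
    (hf : ContDiffOn ℝ ∞ f s) : DifferentiableAt ℝ f x :=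
  (hf.contDiffAt (hs.mem_nhds hx)).differentiableAt (by simp)

theorem contDiffOn_pd {f : (ι → ℝ) → ℝ} (μ : ι) (hs : IsOpen s)
    (hf : ContDiffOn ℝ ∞ f s) : ContDiffOn ℝ ∞ (pd μ f) s := by
  have : ContDiffOn ℝ ∞ (fderiv ℝ f) s := hf.fderiv_of_isOpen hs (by simp)
  exact this.clm_apply contDiffOn_const

theorem pd_comm {f : (ι → ℝ) → ℝ} (μ ν : ι) (hs : IsOpen s) (hx : x ∈ s)
    (hf : ContDiffOn ℝ ∞ f s) : pd μ (pd ν f) x = pd ν (pd μ f) x := by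
  have h2 : ContDiffAt ℝ ∞ f x := hf.contDiffAt (hs.mem_nhds hx)
  have hsym : IsSymmSndFDerivAt ℝ f x := 
    h2.isSymmSndFDerivAt (by simpa using ENat.LEInfty.out)
  have hd : DifferentiableAt ℝ (fderiv ℝ f) x :=
    (h2.fderiv_right (m := ∞) (by simp)).differentiableAt (by simp)
  have key : ∀ α β : ι, pd α (pd β f) x
      = fderiv ℝ (fderiv ℝ f) x (Pi.single α 1) (Pi.single β 1) := by
    intro α β
    unfold pd
    rw [fderiv_clm_apply hd (differentiableAt_const _)]
    simp
  rw [key, key, hsym.eq]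

/-! ### Entrywise derivatives of matrix fields -/

/-- A matrix field whose entries are smooth on `s`. -/
def SmoothMatrixOn (s : Set (ι → ℝ)) (M : (ι → ℝ) → Matrix ι ι ℝ) : Prop :=
  ∀ a b, ContDiffOn ℝ ∞ (fun y => M y a b) s

/-- The entrywise partial derivative of a matrix field. -/
def matPd (c : ι) (M : (ι → ℝ) → Matrix ι ι ℝ) (x : ι → ℝ) : Matrix ι ι ℝ :=
  Matrix.of fun a b => pd c (fun y => M y a b) x

namespace SmoothMatrixOn

variable {M N : (ι → ℝ) → Matrix ι ι ℝ}

theorem add (hM : SmoothMatrixOn s M) (hN : SmoothMatrixOn s N) :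
    SmoothMatrixOn s (fun y => M y + N y) := fun a b => (hM a b).add (hN a b)

theorem sub (hM : SmoothMatrixOn s M) (hN : SmoothMatrixOn s N) :
    SmoothMatrixOn s (fun y => M y - N y) := fun a b => (hM a b).sub (hN a b)

theorem transpose (hM : SmoothMatrixOn s M) :
    SmoothMatrixOn s (fun y => (M y).transpose) := fun a b => hM b a

theorem mul (hM : SmoothMatrixOn s M) (hN : SmoothMatrixOn s N) :
    SmoothMatrixOn s (fun y => M y * N y) := by
  intro a b
  simp only [Matrix.mul_apply]
  exact ContDiffOn.sum fun e _ => (hM a e).mul (hN e b)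

theorem matPd (hs : IsOpen s) (hM : SmoothMatrixOn s M) (c : ι) :
    SmoothMatrixOn s (matPd c M) := fun a b => contDiffOn_pd c hs (hM a b)

theorem det (hM : SmoothMatrixOn s M) : ContDiffOn ℝ ∞ (fun y => (M y).det) s := by
  simp only [Matrix.det_apply']
  exact ContDiffOn.sum fun σ _ =>
    contDiffOn_const.mul (contDiffOn_prod fun i _ => hM _ _)

/-- By Cramer's rule each entry is a quotient of determinants: an adjugate entry is the determinant
of M with one row replaced by a constant row. -/
theorem inv (hM : SmoothMatrixOn s M) (hdet : ∀ y ∈ s, IsUnit (M y).det) :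
    SmoothMatrixOn s (fun y => (M y)⁻¹) := by
  intro a b
  simp only [Matrix.inv_def, Matrix.smul_apply, Ring.inverse_eq_inv', smul_eq_mul,
    Matrix.adjugate_apply]
  refine (hM.det.inv fun y hy => (hdet y hy).ne_zero).mul ?_
  refine SmoothMatrixOn.det fun i j => ?_
  by_cases hi : i = b
  · subst hi; simpa using contDiffOn_const
  · simpa [Matrix.updateRow_ne hi] using hM i j

theorem differentiableAt (hs : IsOpen s) (hx : x ∈ s) (hM : SmoothMatrixOn s M) (a b : ι) :
    DifferentiableAt ℝ (fun y => M y a b) x :=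
  differentiableAt_of_contDiffOn hs hx (hM a b)

end SmoothMatrixOn

variable {M N : (ι → ℝ) → Matrix ι ι ℝ}

theorem matPd_add (hs : IsOpen s) (hx : x ∈ s) (hM : SmoothMatrixOn s M)
    (hN : SmoothMatrixOn s N) (c : ι) :
    matPd c (fun y => M y + N y) x = matPd c M x + matPd c N x := by
  ext a b
  exact pd_add c (hM.differentiableAt hs hx a b) (hN.differentiableAt hs hx a b)

theorem matPd_sub (hs : IsOpen s) (hx : x ∈ s) (hM : SmoothMatrixOn s M)
    (hN : SmoothMatrixOn s N) (c : ι) :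
    matPd c (fun y => M y - N y) x = matPd c M x - matPd c N x := by
  ext a b
  exact pd_sub c (hM.differentiableAt hs hx a b) (hN.differentiableAt hs hx a b)

theorem matPd_mul (hs : IsOpen s) (hx : x ∈ s) (hM : SmoothMatrixOn s M)
    (hN : SmoothMatrixOn s N) (c : ι) :
    matPd c (fun y => M y * N y) x = matPd c M x * N x + M x * matPd c N x := by
  ext a b
  simp only [matPd, Matrix.of_apply, Matrix.mul_apply, Matrix.add_apply]
  rw [pd_sum (f := fun e y => M y a e * N y e b) c fun e _ =>
    (hM.differentiableAt hs hx a e).mul (hN.differentiableAt hs hx e b),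
    ← Finset.sum_add_distrib]
  exact Finset.sum_congr rfl fun e _ =>
    pd_mul c (hM.differentiableAt hs hx a e) (hN.differentiableAt hs hx e b)

theorem matPd_transpose (c : ι) (M : (ι → ℝ) → Matrix ι ι ℝ) (x : ι → ℝ) :
    matPd c (fun y => (M y).transpose) x = (matPd c M x).transpose := rfl

theorem matPd_congr (hs : IsOpen s) (hx : x ∈ s) (h : ∀ y ∈ s, M y = N y) (c : ι) :
    matPd c M x = matPd c N x := by
  ext a b
  exact pd_congr c hs hx fun y hy => by rw [h y hy]

theorem matPd_comm (hs : IsOpen s) (hx : x ∈ s) (hM : SmoothMatrixOn s M) (c d : ι) :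
    matPd c (matPd d M) x = matPd d (matPd c M) x := by
  ext a b
  exact pd_comm c d hs hx (hM a b)

theorem matPd_const (c : ι) (M : Matrix ι ι ℝ) (x : ι → ℝ) : matPd c (fun _ => M) x = 0 := by
  ext a b
  exact pd_const c _ x

/-- **Jacobi's formula** for the derivative of a determinant. -/
theorem pd_det (hs : IsOpen s) (hx : x ∈ s) (hM : SmoothMatrixOn s M) (c : ι) :
    pd c (fun y => (M y).det) x = ((M x).adjugate * matPd c M x).trace := by
  have hd := fun a b => hM.differentiableAt hs hx a b
  have hprod : ∀ σ : Equiv.Perm ι, HasFDerivAt (fun y => ∏ i, M y (σ i) i)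
      (∑ i, (∏ j ∈ Finset.univ.erase i, M x (σ j) j) • fderiv ℝ (fun y => M y (σ i) i) x) x :=
    fun σ => HasFDerivAt.finsetProd fun i _ => (hd (σ i) i).hasFDerivAt
  have hdet : HasFDerivAt (fun y => (M y).det) (∑ σ : Equiv.Perm ι,
      ((Equiv.Perm.sign σ : ℤ) : ℝ) • ∑ i, (∏ j ∈ Finset.univ.erase i, M x (σ j) j) •
        fderiv ℝ (fun y => M y (σ i) i) x) x := by
    simp only [Matrix.det_apply']
    exact HasFDerivAt.fun_sum fun σ _ => (hprod σ).const_mul _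
  have hcol : ∀ i, ((M x).adjugate * matPd c M x) i i
      = ∑ σ : Equiv.Perm ι, ((Equiv.Perm.sign σ : ℤ) : ℝ) *
        ((∏ j ∈ Finset.univ.erase i, M x (σ j) j) * matPd c M x (σ i) i) := by
    intro i
    -- Cramer's rule: the diagonal entry is the determinant of M with column i differentiated, which
    -- is the part of the Leibniz sum where the i-th factor is differentiated.
    have h1 : ((M x).adjugate * matPd c M x) i i
        = ((M x).updateCol i fun j => matPd c M x j i).det := by
      rw [← Matrix.cramer_apply, Matrix.cramer_eq_adjugate_mulVec]
      rfl
    rw [h1, Matrix.det_apply']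
    refine Finset.sum_congr rfl fun σ _ => ?_
    rw [← Finset.prod_erase_mul _ _ (Finset.mem_univ i), Matrix.updateCol_self]
    congr 2
    exact Finset.prod_congr rfl fun j hj => Matrix.updateCol_ne (Finset.ne_of_mem_erase hj)
  rw [pd, hdet.fderiv, Matrix.trace]
  simp only [Matrix.diag_apply, hcol]
  rw [Finset.sum_comm]
  simp [matPd, pd, Finset.mul_sum]

/-- Differentiate M⁻¹ M = 1, which holds throughout the open set `s`, and solve for the derivative
of M⁻¹. -/
theorem matPd_inv (hs : IsOpen s) (hx : x ∈ s) (hM : SmoothMatrixOn s M)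
    (hdet : ∀ y ∈ s, IsUnit (M y).det) (c : ι) :
    matPd c (fun y => (M y)⁻¹) x = -((M x)⁻¹ * matPd c M x * (M x)⁻¹) := by
  have h1 : matPd c (fun y => (M y)⁻¹ * M y) x = 0 := by
    rw [matPd_congr hs hx (fun y hy => Matrix.nonsing_inv_mul (M y) (hdet y hy)) c,
      matPd_const]
  rw [matPd_mul hs hx (hM.inv hdet) hM] at h1
  have h2 : matPd c (fun y => (M y)⁻¹) x * (M x * (M x)⁻¹)
      = -((M x)⁻¹ * matPd c M x * (M x)⁻¹) := by
    rw [← mul_assoc, eq_neg_of_add_eq_zero_left h1, neg_mul]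
  rwa [Matrix.mul_nonsing_inv _ (hdet x hx), mul_one] at h2

end ChartCalculus

end EMFluid

end

/-! ### Levi-Civita connection, curvature matrices and the contracted Bianchi identity. -/

noncomputable section

namespace EMFluid

section Bianchi

variable {ι : Type*} [Fintype ι] [DecidableEq ι] {s : Set (ι → ℝ)} {x : ι → ℝ}
  {g : (ι → ℝ) → Matrix ι ι ℝ}

/-- A smooth pseudo-Riemannian metric on an open set of a coordinate chart. -/
structure IsMetricOn (g : (ι → ℝ) → Matrix ι ι ℝ) (s : Set (ι → ℝ)) : Prop where
  isOpen : IsOpen s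
  smooth : SmoothMatrixOn s g
  symm : ∀ y ∈ s, ∀ a b, g y a b = g y b a
  det : ∀ y ∈ s, IsUnit (g y).det

/-- The connection matrices `(ω_c)^a_b = Γ^a_{cb}`. -/
def connection (g : (ι → ℝ) → Matrix ι ι ℝ) (c : ι) (x : ι → ℝ) : Matrix ι ι ℝ :=
  Matrix.of fun a b => christoffel g a c b x

/-- The curvature matrices `(Ω_{cd})^a_b = R^a_{bcd}`. -/
def curvature (g : (ι → ℝ) → Matrix ι ι ℝ) (c d : ι) (x : ι → ℝ) : Matrix ι ι ℝ :=
  matPd c (connection g d) x - matPd d (connection g c) x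
    + (connection g c x * connection g d x - connection g d x * connection g c x)

/-- The curvature matrices with raised index, `R^{ab}_{cd}`. -/
def curvatureUp (g : (ι → ℝ) → Matrix ι ι ℝ) (c d : ι) (x : ι → ℝ) : Matrix ι ι ℝ :=
  curvature g c d x * (g x)⁻¹

theorem curvature_apply (a b c d : ι) (x : ι → ℝ) :
    curvature g c d x a b = riemann g a b c d x := by
  simp [curvature, riemann, connection, matPd, Matrix.mul_apply, Finset.sum_sub_distrib]

theorem curvature_swap (c d : ι) (x : ι → ℝ) : curvature g c d x = -curvature g d c x := by
  simp only [curvature]; abel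

theorem curvatureUp_swap (c d : ι) (x : ι → ℝ) :
    curvatureUp g c d x = -curvatureUp g d c x := by
  simp only [curvatureUp, curvature_swap c d, neg_mul]

namespace IsMetricOn

theorem inv_symm (hg : IsMetricOn g s) (hx : x ∈ s) (a b : ι) :
    (g x)⁻¹ a b = (g x)⁻¹ b a := by
  have h : (g x).transpose = g x := by ext i j; exact hg.symm x hx j i
  have h2 := Matrix.transpose_nonsing_inv (g x)
  rw [h] at h2
  exact (congrFun (congrFun h2 b) a)

theorem smooth_inv (hg : IsMetricOn g s) : SmoothMatrixOn s (fun y => (g y)⁻¹) :=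
  hg.smooth.inv hg.det

theorem inv_mul (hg : IsMetricOn g s) (hx : x ∈ s) : (g x)⁻¹ * g x = 1 :=
  Matrix.nonsing_inv_mul _ (hg.det x hx)

theorem mul_inv (hg : IsMetricOn g s) (hx : x ∈ s) : g x * (g x)⁻¹ = 1 :=
  Matrix.mul_nonsing_inv _ (hg.det x hx)

theorem smooth_christoffel (hg : IsMetricOn g s) (a b c : ι) :
    ContDiffOn ℝ ∞ (christoffel g a b c) s := by
  unfold christoffel
  refine contDiffOn_const.mul (ContDiffOn.sum fun e _ => (hg.smooth_inv a e).mul ?_)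
  exact ((contDiffOn_pd b hg.isOpen (hg.smooth e c)).add
    (contDiffOn_pd c hg.isOpen (hg.smooth e b))).sub (contDiffOn_pd e hg.isOpen (hg.smooth b c))

theorem smooth_connection (hg : IsMetricOn g s) (c : ι) :
    SmoothMatrixOn s (connection g c) := fun a b => hg.smooth_christoffel a c b

theorem pd_symm (hg : IsMetricOn g s) (hx : x ∈ s) (a b c : ι) :
    pd c (fun y => g y a b) x = pd c (fun y => g y b a) x :=
  pd_congr c hg.isOpen hx fun y hy => hg.symm y hy a b

theorem christoffel_symm (hg : IsMetricOn g s) (hx : x ∈ s) (a b c : ι) :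
    christoffel g a b c x = christoffel g a c b x := by
  unfold christoffel
  congr 1
  refine Finset.sum_congr rfl fun e _ => ?_
  rw [hg.pd_symm hx b c]; ring

/-- Contraction with g cancels the inverse metric in the definition and leaves the Christoffel
symbols of the first kind. -/
theorem lower_christoffel (hg : IsMetricOn g s) (hx : x ∈ s) (a b c : ι) :
    ∑ e, g x a e * christoffel g e b c x = 1 / 2 * (pd b (fun y => g y a c) x
      + pd c (fun y => g y a b) x - pd a (fun y => g y b c) x) := by
  have h : ∀ v : ι → ℝ, ∑ e, g x a e * ∑ f, (g x)⁻¹ e f * v f = v a := fun v => by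
    have : g x *ᵥ ((g x)⁻¹ *ᵥ v) = v := by
      rw [Matrix.mulVec_mulVec, hg.mul_inv hx, Matrix.one_mulVec]
    exact congrFun this a
  have := h fun e => pd b (fun y => g y e c) x + pd c (fun y => g y e b) x
    - pd e (fun y => g y b c) x
  rw [← this, Finset.mul_sum]
  refine Finset.sum_congr rfl fun e _ => ?_
  rw [christoffel]; ring

/-- Metric compatibility of the Levi-Civita connection. -/
theorem matPd_metric (hg : IsMetricOn g s) (hx : x ∈ s) (c : ι) :
    matPd c g x = g x * connection g c x + (connection g c x).transpose * g x := by
  ext a b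
  have h1 := hg.lower_christoffel hx a c b
  have h2 := hg.lower_christoffel hx b c a
  simp only [matPd, connection, Matrix.of_apply, Matrix.add_apply, Matrix.mul_apply,
    Matrix.transpose_apply]
  have h3 : ∑ e, christoffel g e c a x * g x e b = ∑ e, g x b e * christoffel g e c a x :=
    Finset.sum_congr rfl fun e _ => by rw [hg.symm x hx e b, mul_comm]
  rw [h3, h1, h2, hg.pd_symm hx b a c, hg.pd_symm hx c b a, hg.pd_symm hx c a b]
  ring

theorem matPd_inv_metric (hg : IsMetricOn g s) (hx : x ∈ s) (c : ι) :
    matPd c (fun y => (g y)⁻¹) x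
      = -(connection g c x * (g x)⁻¹ + (g x)⁻¹ * (connection g c x).transpose) := by
  rw [matPd_inv hg.isOpen hx hg.smooth hg.det, hg.matPd_metric hx, mul_add, add_mul,
    ← mul_assoc, hg.inv_mul hx, one_mul, mul_assoc _ _ ((g x)⁻¹), mul_assoc _ (g x),
    hg.mul_inv hx, mul_one]

theorem smooth_curvature (hg : IsMetricOn g s) (c d : ι) :
    SmoothMatrixOn s (curvature g c d) :=
  (((hg.smooth_connection d).matPd hg.isOpen c).sub
    ((hg.smooth_connection c).matPd hg.isOpen d)).add
    (((hg.smooth_connection c).mul (hg.smooth_connection d)).sub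
      ((hg.smooth_connection d).mul (hg.smooth_connection c)))

theorem smooth_curvatureUp (hg : IsMetricOn g s) (c d : ι) :
    SmoothMatrixOn s (curvatureUp g c d) := (hg.smooth_curvature c d).mul hg.smooth_inv

theorem matPd_matPd_metric (hg : IsMetricOn g s) (hx : x ∈ s) (c d : ι) :
    matPd d (matPd c g) x = matPd d g x * connection g c x
      + g x * matPd d (connection g c) x
      + ((matPd d (connection g c) x).transpose * g x
        + (connection g c x).transpose * matPd d g x) := by
  have hc := hg.smooth_connection c
  rw [matPd_congr hg.isOpen hx (fun y hy => hg.matPd_metric hy c) d,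
    matPd_add hg.isOpen hx (hg.smooth.mul hc) (hc.transpose.mul hg.smooth),
    matPd_mul hg.isOpen hx hg.smooth hc, matPd_mul hg.isOpen hx hc.transpose hg.smooth,
    matPd_transpose]

/-- Mixed partial derivatives of the metric commute. Expressing both orders through metric
compatibility, their difference is exactly the symmetric part of the lowered curvature. -/
theorem curvature_antisymm (hg : IsMetricOn g s) (hx : x ∈ s) (c d : ι) :
    g x * curvature g c d x + (curvature g c d x).transpose * g x = 0 := by
  have h := matPd_comm hg.isOpen hx hg.smooth c d
  rw [hg.matPd_matPd_metric hx, hg.matPd_matPd_metric hx, hg.matPd_metric hx,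
    hg.matPd_metric hx] at h
  have h' := sub_eq_zero.mpr h
  rw [← h']
  simp only [curvature, Matrix.transpose_add, Matrix.transpose_sub, Matrix.transpose_mul]
  noncomm_ring

theorem curvatureUp_transpose (hg : IsMetricOn g s) (hx : x ∈ s) (c d : ι) :
    (curvatureUp g c d x).transpose = -curvatureUp g c d x := by
  have h := hg.curvature_antisymm hx c d
  have h1 : (g x)⁻¹ * (g x * curvature g c d x + (curvature g c d x).transpose * g x)
      * (g x)⁻¹ = 0 := by rw [h]; simp
  have hs : ((g x)⁻¹).transpose = (g x)⁻¹ := by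
    ext i j; exact hg.inv_symm hx j i
  rw [mul_add, add_mul, ← mul_assoc, hg.inv_mul hx, one_mul, mul_assoc _ (_ * g x),
    mul_assoc _ (g x), hg.mul_inv hx, mul_one] at h1
  rw [curvatureUp, Matrix.transpose_mul, hs]
  exact eq_neg_of_add_eq_zero_right h1

theorem matPd_curvature (hg : IsMetricOn g s) (hx : x ∈ s) (c d e : ι) :
    matPd e (curvature g c d) x = matPd e (matPd c (connection g d)) x
      - matPd e (matPd d (connection g c)) x
      + (matPd e (connection g c) x * connection g d x
        + connection g c x * matPd e (connection g d) x
        - (matPd e (connection g d) x * connection g c x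
          + connection g d x * matPd e (connection g c) x)) := by
  have hc := hg.smooth_connection c
  have hd := hg.smooth_connection d
  have ho := hg.isOpen
  unfold curvature
  rw [matPd_add ho hx ((hd.matPd ho c).sub (hc.matPd ho d)) ((hc.mul hd).sub (hd.mul hc)),
    matPd_sub ho hx (hd.matPd ho c) (hc.matPd ho d),
    matPd_sub ho hx (hc.mul hd) (hd.mul hc), matPd_mul ho hx hc hd, matPd_mul ho hx hd hc]

/-- The covariant derivative of the curvature matrices with raised index. -/
theorem matPd_curvatureUp (hg : IsMetricOn g s) (hx : x ∈ s) (c d e : ι) :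
    matPd e (curvatureUp g c d) x + connection g e x * curvatureUp g c d x
        + curvatureUp g c d x * (connection g e x).transpose
      = (matPd e (curvature g c d) x + connection g e x * curvature g c d x
        - curvature g c d x * connection g e x) * (g x)⁻¹ := by
  unfold curvatureUp
  rw [matPd_mul hg.isOpen hx (hg.smooth_curvature c d) hg.smooth_inv,
    hg.matPd_inv_metric hx]
  noncomm_ring

/-- The second Bianchi identity. -/
theorem second_bianchi (hg : IsMetricOn g s) (hx : x ∈ s) (c d e : ι) :
    (matPd e (curvatureUp g c d) x + connection g e x * curvatureUp g c d x
        + curvatureUp g c d x * (connection g e x).transpose)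
      + (matPd c (curvatureUp g d e) x + connection g c x * curvatureUp g d e x
        + curvatureUp g d e x * (connection g c x).transpose)
      + (matPd d (curvatureUp g e c) x + connection g d x * curvatureUp g e c x
        + curvatureUp g e c x * (connection g d x).transpose) = 0 := by
  -- This is the Cartan form DΩ = 0: no Christoffel terms act on the two lower indices, as they
  -- cancel in the cyclic sum. Second derivatives of the connection cancel by commutation, and the
  -- rest is an identity in a noncommutative ring.
  have hcm := fun a b f => matPd_comm hg.isOpen hx (hg.smooth_connection f) a b
  rw [hg.matPd_curvatureUp hx, hg.matPd_curvatureUp hx, hg.matPd_curvatureUp hx,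
    ← add_mul, ← add_mul, hg.matPd_curvature hx, hg.matPd_curvature hx, hg.matPd_curvature hx,
    hcm d c e, hcm e d c, hcm e c d]
  convert zero_mul _
  simp only [curvature]
  noncomm_ring

end IsMetricOn

/-- The Ricci tensor with raised first index, `R^b_d = R^{ab}_{ad}`. -/
def ricciMixed (g : (ι → ℝ) → Matrix ι ι ℝ) (b d : ι) (x : ι → ℝ) : ℝ :=
  ∑ a, curvatureUp g a d x a b

/-- The Einstein tensor with raised first index. -/
def einsteinMixed (g : (ι → ℝ) → Matrix ι ι ℝ) (c e : ι) (x : ι → ℝ) : ℝ :=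
  ∑ f, (g x)⁻¹ c f * einsteinTensor g f e x

/-- The covariant divergence `∇_c T^c_e` of a mixed tensor. -/
def mixedDivergence (g : (ι → ℝ) → Matrix ι ι ℝ) (T : ι → ι → (ι → ℝ) → ℝ) (e : ι)
    (x : ι → ℝ) : ℝ :=
  ∑ c, pd c (T c e) x + (∑ c, ∑ f, christoffel g c c f x * T f e x
    - ∑ c, ∑ f, christoffel g c e f x * T f c x)

namespace IsMetricOn

theorem smooth_ricciMixed (hg : IsMetricOn g s) (b d : ι) :
    ContDiffOn ℝ ∞ (ricciMixed g b d) s :=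
  ContDiffOn.sum fun a _ => hg.smooth_curvatureUp a d a b

theorem sum_inv_mul_ricci (hg : IsMetricOn g s) (hx : x ∈ s) (c e : ι) :
    ∑ f, (g x)⁻¹ c f * ricci g f e x = ricciMixed g c e x := by
  simp only [ricci, ricciMixed, curvatureUp, Matrix.mul_apply, curvature_apply, Finset.mul_sum]
  rw [Finset.sum_comm]
  refine Finset.sum_congr rfl fun a _ => Finset.sum_congr rfl fun f _ => ?_
  rw [hg.inv_symm hx c f, mul_comm]

theorem scalarCurvature_eq (hg : IsMetricOn g s) (hx : x ∈ s) :
    scalarCurvature g x = ∑ d, ricciMixed g d d x := by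
  simp only [scalarCurvature, ← hg.sum_inv_mul_ricci hx]
  rw [Finset.sum_comm]
  refine Finset.sum_congr rfl fun a _ => Finset.sum_congr rfl fun b _ => ?_
  rw [hg.inv_symm hx a b]

theorem einsteinMixed_eq (hg : IsMetricOn g s) (hx : x ∈ s) (c e : ι) :
    einsteinMixed g c e x = ricciMixed g c e x
      - 1 / 2 * ((1 : Matrix ι ι ℝ) c e * ∑ d, ricciMixed g d d x) := by
  rw [← hg.scalarCurvature_eq hx, ← hg.inv_mul hx, Matrix.mul_apply, Finset.sum_mul,
    Finset.mul_sum, ← hg.sum_inv_mul_ricci hx, ← Finset.sum_sub_distrib, einsteinMixed]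
  refine Finset.sum_congr rfl fun f _ => ?_
  rw [einsteinTensor]; ring

theorem curvatureUp_swap_up (hg : IsMetricOn g s) (hx : x ∈ s) (a b c d : ι) :
    curvatureUp g c d x a b = -curvatureUp g c d x b a := by
  have := congrFun (congrFun (hg.curvatureUp_transpose hx c d) b) a
  simpa using this

/-- The curvature is antisymmetric in its upper pair and the Christoffel symbol symmetric in its
lower pair. -/
theorem sum_curvatureUp_mul_christoffel (hg : IsMetricOn g s) (hx : x ∈ s) (a c d : ι) :
    ∑ e, ∑ f, curvatureUp g c d x e f * christoffel g a e f x = 0 := by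
  have h : ∑ e, ∑ f, curvatureUp g c d x e f * christoffel g a e f x
      = -∑ e, ∑ f, curvatureUp g c d x e f * christoffel g a e f x := by
    conv_lhs => rw [Finset.sum_comm]
    simp only [← Finset.sum_neg_distrib]
    refine Finset.sum_congr rfl fun e _ => Finset.sum_congr rfl fun f _ => ?_
    rw [hg.curvatureUp_swap_up hx f e, hg.christoffel_symm hx a f e]; ring
  linarith

/-- The contracted Bianchi identity for the Ricci tensor. -/
theorem mixedDivergence_ricci (hg : IsMetricOn g s) (hx : x ∈ s) (e : ι) :
    2 * mixedDivergence g (ricciMixed g) e x = pd e (fun y => ∑ d, ricciMixed g d d y) x := by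
  have hM := fun c d a b => (hg.smooth_curvatureUp c d).differentiableAt hg.isOpen hx a b
  have hB : ∀ c d, (pd e (fun y => curvatureUp g c d y c d) x
      + ∑ f, christoffel g c e f x * curvatureUp g c d x f d
      + ∑ f, curvatureUp g c d x c f * christoffel g d e f x)
      + (pd c (fun y => curvatureUp g d e y c d) x
      + ∑ f, christoffel g c c f x * curvatureUp g d e x f d
      + ∑ f, curvatureUp g d e x c f * christoffel g d c f x)
      + (pd d (fun y => curvatureUp g e c y c d) x
      + ∑ f, christoffel g c d f x * curvatureUp g e c x f d
      + ∑ f, curvatureUp g e c x c f * christoffel g d d f x) = 0 := fun c d => by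
    have := congrFun (congrFun (hg.second_bianchi hx c d e) c) d
    simpa [Matrix.mul_apply, matPd, connection] using this
  have hsum : ∑ c, ∑ d, _ = ∑ c : ι, ∑ d : ι, (0 : ℝ) :=
    Finset.sum_congr rfl fun c _ => Finset.sum_congr rfl fun d _ => hB c d
  simp only [Finset.sum_add_distrib, Finset.sum_const_zero] at hsum
  -- The nine terms of the doubly contracted identity: `s1` is the derivative of the scalar
  -- curvature; the pairs `s4`, `s7` and `s5`, `s9` and `s2`, `s3` each give one term of the
  -- divergence twice; `s6` and `s8` vanish by symmetry.
  have s1 : ∑ c, ∑ d, pd e (fun y => curvatureUp g c d y c d) x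
      = pd e (fun y => ∑ d, ricciMixed g d d y) x := by
    rw [pd_sum (f := fun d => ricciMixed g d d) e fun d _ =>
      differentiableAt_of_contDiffOn hg.isOpen hx (hg.smooth_ricciMixed d d), Finset.sum_comm]
    exact Finset.sum_congr rfl fun d _ => (pd_sum e fun c _ => hM c d c d).symm
  have s2 : ∑ c, ∑ d, ∑ f, christoffel g c e f x * curvatureUp g c d x f d
      = ∑ c, ∑ f, christoffel g c e f x * ricciMixed g f c x := by
    refine Finset.sum_congr rfl fun c _ => ?_
    rw [Finset.sum_comm]
    refine Finset.sum_congr rfl fun f _ => ?_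
    rw [ricciMixed, Finset.mul_sum]
    refine Finset.sum_congr rfl fun d _ => ?_
    rw [curvatureUp_swap c d, Matrix.neg_apply, hg.curvatureUp_swap_up hx f d, neg_neg]
  have s3 : ∑ c, ∑ d, ∑ f, curvatureUp g c d x c f * christoffel g d e f x
      = ∑ c, ∑ f, christoffel g c e f x * ricciMixed g f c x := by
    rw [Finset.sum_comm]
    refine Finset.sum_congr rfl fun d _ => ?_
    rw [Finset.sum_comm]
    refine Finset.sum_congr rfl fun f _ => ?_
    rw [ricciMixed, Finset.mul_sum]
    exact Finset.sum_congr rfl fun c _ => mul_comm _ _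
  have s4 : ∑ c, ∑ d, pd c (fun y => curvatureUp g d e y c d) x
      = -∑ c, pd c (ricciMixed g c e) x := by
    rw [← Finset.sum_neg_distrib]
    refine Finset.sum_congr rfl fun c _ => ?_
    unfold ricciMixed
    rw [pd_sum (f := fun d y => curvatureUp g d e y d c) c fun d _ => hM d e d c,
      ← Finset.sum_neg_distrib]
    refine Finset.sum_congr rfl fun d _ => ?_
    rw [← pd_neg]
    exact pd_congr c hg.isOpen hx fun y hy => hg.curvatureUp_swap_up hy c d d e
  have s5 : ∑ c, ∑ d, ∑ f, christoffel g c c f x * curvatureUp g d e x f d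
      = -∑ c, ∑ f, christoffel g c c f x * ricciMixed g f e x := by
    simp only [← Finset.sum_neg_distrib]
    refine Finset.sum_congr rfl fun c _ => ?_
    rw [Finset.sum_comm]
    refine Finset.sum_congr rfl fun f _ => ?_
    rw [ricciMixed, Finset.mul_sum, ← Finset.sum_neg_distrib]
    refine Finset.sum_congr rfl fun d _ => ?_
    rw [hg.curvatureUp_swap_up hx f d]; ring
  have s6 : ∑ c, ∑ d, ∑ f, curvatureUp g d e x c f * christoffel g d c f x = 0 := by
    rw [Finset.sum_comm]
    exact Finset.sum_eq_zero fun d _ => hg.sum_curvatureUp_mul_christoffel hx d d e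
  have s7 : ∑ c, ∑ d, pd d (fun y => curvatureUp g e c y c d) x
      = -∑ c, pd c (ricciMixed g c e) x := by
    rw [Finset.sum_comm, ← Finset.sum_neg_distrib]
    refine Finset.sum_congr rfl fun d _ => ?_
    unfold ricciMixed
    rw [pd_sum (f := fun c y => curvatureUp g c e y c d) d fun c _ => hM c e c d,
      ← Finset.sum_neg_distrib]
    refine Finset.sum_congr rfl fun c _ => ?_
    rw [← pd_neg]
    exact pd_congr d hg.isOpen hx fun y hy => by rw [curvatureUp_swap e c, Matrix.neg_apply]
  have s8 : ∑ c, ∑ d, ∑ f, christoffel g c d f x * curvatureUp g e c x f d = 0 := by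
    refine Finset.sum_eq_zero fun c _ => ?_
    rw [Finset.sum_comm, ← hg.sum_curvatureUp_mul_christoffel hx c e c]
    refine Finset.sum_congr rfl fun f _ => Finset.sum_congr rfl fun d _ => ?_
    rw [hg.christoffel_symm hx c d f, mul_comm]
  have s9 : ∑ c, ∑ d, ∑ f, curvatureUp g e c x c f * christoffel g d d f x
      = -∑ c, ∑ f, christoffel g c c f x * ricciMixed g f e x := by
    rw [Finset.sum_comm]
    simp only [← Finset.sum_neg_distrib]
    refine Finset.sum_congr rfl fun d _ => ?_
    rw [Finset.sum_comm]
    refine Finset.sum_congr rfl fun f _ => ?_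
    rw [ricciMixed, Finset.mul_sum, ← Finset.sum_neg_distrib]
    refine Finset.sum_congr rfl fun c _ => ?_
    rw [curvatureUp_swap e c, Matrix.neg_apply]; ring
  rw [s1, s2, s3, s4, s5, s6, s7, s8, s9] at hsum
  rw [mixedDivergence]
  linarith

/-- The contracted Bianchi identity. -/
theorem mixedDivergence_einstein (hg : IsMetricOn g s) (hx : x ∈ s) (e : ι) :
    mixedDivergence g (einsteinMixed g) e x = 0 := by
  have hR := hg.mixedDivergence_ricci hx e
  have hdR := fun c d => differentiableAt_of_contDiffOn hg.isOpen hx (hg.smooth_ricciMixed c d)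
  set R : (ι → ℝ) → ℝ := fun y => ∑ d, ricciMixed g d d y with hRdef
  have hdS : DifferentiableAt ℝ R x := DifferentiableAt.fun_sum fun d _ => hdR d d
  have h1 : ∀ c, pd c (einsteinMixed g c e) x
      = pd c (ricciMixed g c e) x - 1 / 2 * ((1 : Matrix ι ι ℝ) c e * pd c R x) := by
    intro c
    rw [pd_congr c hg.isOpen hx fun y hy => hg.einsteinMixed_eq hy c e,
      pd_sub c (hdR c e) ((hdS.const_mul _).const_mul _),
      pd_mul c (differentiableAt_const _) (hdS.const_mul _),
      pd_mul c (differentiableAt_const _) hdS, pd_const, pd_const]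
    ring
  rw [mixedDivergence] at hR ⊢
  simp only [h1, hg.einsteinMixed_eq hx, Finset.sum_sub_distrib, mul_sub, Matrix.one_apply]
  simp only [ite_mul, mul_ite, one_mul, zero_mul, mul_zero, Finset.sum_ite_eq',
    Finset.mem_univ, if_true]
  -- The two connection terms acting on the trace part δ R/2 cancel, since the connection is
  -- torsion-free.
  have h2 : ∑ c, christoffel g c c e x * (1 / 2 * ∑ d, ricciMixed g d d x)
      = ∑ c, christoffel g c e c x * (1 / 2 * ∑ d, ricciMixed g d d x) :=
    Finset.sum_congr rfl fun c _ => by rw [hg.christoffel_symm hx c c e]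
  linarith

end IsMetricOn

end Bianchi

end EMFluid

end

/-! ### Christoffel symbols and time-time Ricci component of the static metric. -/

noncomputable section

namespace EMFluid

section SpatialOperators

variable {ι : Type*} [Fintype ι] [DecidableEq ι]

/-- The gradient `∇^i f = h^{ij} ∂_j f`. -/
def gradient (h : (ι → ℝ) → Matrix ι ι ℝ) (f : (ι → ℝ) → ℝ) (i : ι) (y : ι → ℝ) : ℝ :=
  ∑ j, (h y)⁻¹ i j * pd j f y

/-- The divergence `∇_i V^i` of a vector field. -/
def divergence (h : (ι → ℝ) → Matrix ι ι ℝ) (V : ι → (ι → ℝ) → ℝ) (y : ι → ℝ) : ℝ :=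
  ∑ i, (pd i (V i) y + (∑ k, christoffel h k k i y) * V i y)

theorem contDiffOn_gradient {h : (ι → ℝ) → Matrix ι ι ℝ} {Ω : Set (ι → ℝ)}
    (hh : IsMetricOn h Ω) {f : (ι → ℝ) → ℝ} (hf : ContDiffOn ℝ ∞ f Ω) (i : ι) :
    ContDiffOn ℝ ∞ (gradient h f i) Ω :=
  ContDiffOn.sum fun j _ => (hh.smooth_inv i j).mul (contDiffOn_pd j hh.isOpen hf)

end SpatialOperators

namespace StaticFluid

variable {n : ℕ} {X : StaticFluid n} {G : ℝ} {Ω : Set (Fin n → ℝ)} {x : Index n → ℝ}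

theorem contDiff_space : ContDiff ℝ ∞ (space (n := n)) := by
  unfold space; fun_prop

theorem hasFDerivAt_space (x : Index n → ℝ) : HasFDerivAt (space (n := n))
    (ContinuousLinearMap.pi fun i => ContinuousLinearMap.proj (R := ℝ) (Sum.inr i)) x :=
  (ContinuousLinearMap.pi fun i =>
    ContinuousLinearMap.proj (R := ℝ) (φ := fun _ : Index n => ℝ) (Sum.inr i)).hasFDerivAt

theorem pd_time {f : (Fin n → ℝ) → ℝ} (hf : DifferentiableAt ℝ f (space x)) (a : Fin 1) :
    pd (Sum.inl a) (fun z => f (space z)) x = 0 := by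
  have h := (hf.hasFDerivAt.comp x (hasFDerivAt_space x)).fderiv
  have h2 : (ContinuousLinearMap.pi fun i => ContinuousLinearMap.proj (R := ℝ)
      (φ := fun _ : Index n => ℝ) (Sum.inr i)) (Pi.single (Sum.inl a) 1) = (0 : Fin n → ℝ) := by
    ext i; simp
  rw [pd, show (fun z => f (space z)) = f ∘ space from rfl, h,
    ContinuousLinearMap.comp_apply, h2, map_zero]

theorem pd_space {f : (Fin n → ℝ) → ℝ} (hf : DifferentiableAt ℝ f (space x)) (i : Fin n) :
    pd (Sum.inr i) (fun z => f (space z)) x = pd i f (space x) := by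
  have h := (hf.hasFDerivAt.comp x (hasFDerivAt_space x)).fderiv
  have h2 : (ContinuousLinearMap.pi fun i => ContinuousLinearMap.proj (R := ℝ)
      (φ := fun _ : Index n => ℝ) (Sum.inr i)) (Pi.single (Sum.inr i) 1)
      = (Pi.single i 1 : Fin n → ℝ) := by
    ext j
    by_cases hj : j = i
    · subst hj; simp
    · simp [hj]
  rw [pd, show (fun z => f (space z)) = f ∘ space from rfl, h,
    ContinuousLinearMap.comp_apply, h2, pd]

namespace IsEinsteinMaxwell

theorem spatial (hX : X.IsEinsteinMaxwell G Ω) (hΩ : IsOpen Ω) : IsMetricOn X.h Ω where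
  isOpen := hΩ
  smooth := hX.smooth_h
  symm y hy a b := by simpa using ((hX.h_posDef y hy).isHermitian.apply b a)
  det y hy := (hX.h_posDef y hy).det_pos.ne'.isUnit

theorem metric_inv (hX : X.IsEinsteinMaxwell G Ω) (hx : space x ∈ Ω) :
    (X.metric x)⁻¹
      = Matrix.fromBlocks (Matrix.of fun _ _ => -(X.W (space x) ^ 2)⁻¹) 0 0 (X.h (space x))⁻¹ := by
  apply Matrix.inv_eq_right_inv
  have hW := (hX.W_pos _ hx).ne'
  rw [metric, Matrix.fromBlocks_multiply]
  have h1 : X.h (space x) * (X.h (space x))⁻¹ = 1 :=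
    Matrix.mul_nonsing_inv _ (hX.h_posDef _ hx).det_pos.ne'.isUnit
  have h2 : (Matrix.of fun _ _ => -(X.W (space x)) ^ 2 : Matrix (Fin 1) (Fin 1) ℝ)
      * (Matrix.of fun _ _ => -(X.W (space x) ^ 2)⁻¹) = 1 := by
    ext i j
    fin_cases i; fin_cases j
    simp [Matrix.mul_apply]
    field_simp
  simp [h1, h2]

theorem spacetime (hX : X.IsEinsteinMaxwell G Ω) (hΩ : IsOpen Ω) :
    IsMetricOn X.metric (space ⁻¹' Ω) where
  isOpen := hΩ.preimage contDiff_space.continuous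
  smooth := by
    have hm : Set.MapsTo (space (n := n)) (space ⁻¹' Ω) Ω := Set.mapsTo_preimage _ _
    rintro (a | i) (b | j)
    · exact ((hX.smooth_W.comp contDiff_space.contDiffOn hm).pow 2).neg
    · exact contDiffOn_const
    · exact contDiffOn_const
    · exact (hX.smooth_h i j).comp contDiff_space.contDiffOn hm
  symm := by
    rintro x hx (a | i) (b | j)
    · rfl
    · rfl
    · rfl
    · exact (hX.spatial hΩ).symm _ hx i j
  det x hx := by
    have hW := (hX.W_pos _ hx).ne'
    have h2 := (hX.h_posDef _ hx).det_pos.ne'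
    rw [metric, Matrix.det_fromBlocks_zero₂₁]
    simp [hW, h2]

theorem diff_W (hX : X.IsEinsteinMaxwell G Ω) (hΩ : IsOpen Ω) {y : Fin n → ℝ} (hy : y ∈ Ω) :
    DifferentiableAt ℝ X.W y := differentiableAt_of_contDiffOn hΩ hy hX.smooth_W

theorem diff_φ (hX : X.IsEinsteinMaxwell G Ω) (hΩ : IsOpen Ω) {y : Fin n → ℝ} (hy : y ∈ Ω) :
    DifferentiableAt ℝ X.φ y := differentiableAt_of_contDiffOn hΩ hy hX.smooth_φ

theorem diff_p (hX : X.IsEinsteinMaxwell G Ω) (hΩ : IsOpen Ω) {y : Fin n → ℝ} (hy : y ∈ Ω) :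
    DifferentiableAt ℝ X.p y := differentiableAt_of_contDiffOn hΩ hy hX.smooth_p

/-! ### Derivatives of the metric -/

theorem pd_metric_time (hX : X.IsEinsteinMaxwell G Ω) (hΩ : IsOpen Ω) (hx : space x ∈ Ω)
    (a : Fin 1) (μ ν : Index n) : pd (Sum.inl a) (fun z => X.metric z μ ν) x = 0 := by
  have hW := hX.diff_W hΩ hx
  rcases μ with b | i <;> rcases ν with c | j
  · exact pd_time (f := fun y => -(X.W y) ^ 2) (by fun_prop) a
  · exact pd_const _ _ _
  · exact pd_const _ _ _
  · exact pd_time (f := fun y => X.h y i j)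
      (differentiableAt_of_contDiffOn hΩ hx (hX.smooth_h i j)) a

theorem pd_metric_inl_inl (hX : X.IsEinsteinMaxwell G Ω) (hΩ : IsOpen Ω) (hx : space x ∈ Ω)
    (i : Fin n) (a b : Fin 1) : pd (Sum.inr i) (fun z => X.metric z (Sum.inl a) (Sum.inl b)) x
      = -2 * X.W (space x) * pd i X.W (space x) := by
  have hW := hX.diff_W hΩ hx
  have h1 : pd (Sum.inr i) (fun z => X.metric z (Sum.inl a) (Sum.inl b)) x
      = pd i (fun y => -(X.W y * X.W y)) (space x) := by
    rw [← pd_space (f := fun y => -(X.W y * X.W y)) (by fun_prop) i]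
    simp [metric, pow_two]
  rw [h1, pd_neg, pd_mul i hW hW]; ring

theorem pd_metric_inr_inr (hX : X.IsEinsteinMaxwell G Ω) (hΩ : IsOpen Ω) (hx : space x ∈ Ω)
    (i j k : Fin n) : pd (Sum.inr i) (fun z => X.metric z (Sum.inr j) (Sum.inr k)) x
      = pd i (fun y => X.h y j k) (space x) :=
  pd_space (differentiableAt_of_contDiffOn hΩ hx (hX.smooth_h j k)) i

theorem pd_metric_inl_inr (μ : Index n) (a : Fin 1) (i : Fin n) (x : Index n → ℝ) :
    pd μ (fun z => X.metric z (Sum.inl a) (Sum.inr i)) x = 0 := pd_const _ _ _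

theorem pd_metric_inr_inl (μ : Index n) (a : Fin 1) (i : Fin n) (x : Index n → ℝ) :
    pd μ (fun z => X.metric z (Sum.inr i) (Sum.inl a)) x = 0 := pd_const _ _ _

/-! ### Christoffel symbols of the static metric -/

theorem christoffel_inl_inl_inl (hX : X.IsEinsteinMaxwell G Ω) (hΩ : IsOpen Ω)
    (hx : space x ∈ Ω) (a b c : Fin 1) :
    christoffel X.metric (Sum.inl a) (Sum.inl b) (Sum.inl c) x = 0 := by
  simp [christoffel, hX.metric_inv hx, hX.pd_metric_time hΩ hx]

theorem christoffel_inl_inl_inr (hX : X.IsEinsteinMaxwell G Ω) (hΩ : IsOpen Ω)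
    (hx : space x ∈ Ω) (a b : Fin 1) (i : Fin n) :
    christoffel X.metric (Sum.inl a) (Sum.inl b) (Sum.inr i) x
      = pd i X.W (space x) / X.W (space x) := by
  have hW := (hX.W_pos _ hx).ne'
  simp [christoffel, hX.metric_inv hx, hX.pd_metric_time hΩ hx, pd_metric_inl_inr,
    hX.pd_metric_inl_inl hΩ hx]
  field_simp

theorem christoffel_inl_inr_inr (hX : X.IsEinsteinMaxwell G Ω) (hΩ : IsOpen Ω)
    (hx : space x ∈ Ω) (a : Fin 1) (i j : Fin n) :
    christoffel X.metric (Sum.inl a) (Sum.inr i) (Sum.inr j) x = 0 := by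
  simp [christoffel, hX.metric_inv hx, hX.pd_metric_time hΩ hx, pd_metric_inl_inr]

theorem christoffel_inr_inl_inl (hX : X.IsEinsteinMaxwell G Ω) (hΩ : IsOpen Ω)
    (hx : space x ∈ Ω) (a b : Fin 1) (i : Fin n) :
    christoffel X.metric (Sum.inr i) (Sum.inl a) (Sum.inl b) x
      = X.W (space x) * gradient X.h X.W i (space x) := by
  simp [christoffel, hX.metric_inv hx, hX.pd_metric_time hΩ hx,
    hX.pd_metric_inl_inl hΩ hx, gradient, Finset.mul_sum]
  refine Finset.sum_congr rfl fun j _ => ?_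
  ring

theorem christoffel_inr_inl_inr (hX : X.IsEinsteinMaxwell G Ω) (hΩ : IsOpen Ω)
    (hx : space x ∈ Ω) (a : Fin 1) (i j : Fin n) :
    christoffel X.metric (Sum.inr i) (Sum.inl a) (Sum.inr j) x = 0 := by
  simp [christoffel, hX.metric_inv hx, hX.pd_metric_time hΩ hx, pd_metric_inr_inl,
    pd_metric_inl_inr]

theorem christoffel_inr_inr_inr (hX : X.IsEinsteinMaxwell G Ω) (hΩ : IsOpen Ω)
    (hx : space x ∈ Ω) (i j k : Fin n) :
    christoffel X.metric (Sum.inr i) (Sum.inr j) (Sum.inr k) x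
      = christoffel X.h i j k (space x) := by
  simp [christoffel, hX.metric_inv hx, hX.pd_metric_inr_inr hΩ hx]

theorem christoffel_inl_inr_inl (hX : X.IsEinsteinMaxwell G Ω) (hΩ : IsOpen Ω)
    (hx : space x ∈ Ω) (a b : Fin 1) (i : Fin n) :
    christoffel X.metric (Sum.inl a) (Sum.inr i) (Sum.inl b) x
      = pd i X.W (space x) / X.W (space x) := by
  rw [(hX.spacetime hΩ).christoffel_symm hx, hX.christoffel_inl_inl_inr hΩ hx]

theorem christoffel_inr_inr_inl (hX : X.IsEinsteinMaxwell G Ω) (hΩ : IsOpen Ω)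
    (hx : space x ∈ Ω) (a : Fin 1) (i j : Fin n) :
    christoffel X.metric (Sum.inr i) (Sum.inr j) (Sum.inl a) x = 0 := by
  rw [(hX.spacetime hΩ).christoffel_symm hx, hX.christoffel_inr_inl_inr hΩ hx]

/-- The time-time component of the Ricci tensor of a static metric. -/
theorem ricci_inl_inl (hX : X.IsEinsteinMaxwell G Ω) (hΩ : IsOpen Ω) (hx : space x ∈ Ω) :
    ricci X.metric (Sum.inl 0) (Sum.inl 0) x
      = X.W (space x) * divergence X.h (gradient X.h X.W) (space x) := by
  have hg := hX.spacetime hΩ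
  have hd := fun i => differentiableAt_of_contDiffOn hΩ hx
    (contDiffOn_gradient (hX.spatial hΩ) hX.smooth_W i)
  have h1 : ∀ i, pd (Sum.inr i) (christoffel X.metric (Sum.inr i) (Sum.inl 0) (Sum.inl 0)) x
      = pd i X.W (space x) * gradient X.h X.W i (space x)
        + X.W (space x) * pd i (gradient X.h X.W i) (space x) := by
    intro i
    rw [pd_congr _ hg.isOpen hx fun z hz => hX.christoffel_inr_inl_inl hΩ hz 0 0 i,
      pd_space (f := fun y => X.W y * gradient X.h X.W i y) ((hX.diff_W hΩ hx).mul (hd i)),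
      pd_mul i (hX.diff_W hΩ hx) (hd i)]
  have h2 : ∀ i, pd (Sum.inl 0) (christoffel X.metric (Sum.inr i) (Sum.inr i) (Sum.inl 0)) x
      = 0 := by
    intro i
    rw [pd_congr _ hg.isOpen hx fun z hz => hX.christoffel_inr_inr_inl hΩ hz 0 i i, pd_const]
  have hW := (hX.W_pos _ hx).ne'
  -- The product of Γ^i_{00} and Γ^0_{i0} is ∇^i W ∂_i W, and it cancels the term where the
  -- derivative of W ∇^i W falls on the factor W.
  have h3 : ∀ i, riemann X.metric (Sum.inr i) (Sum.inl 0) (Sum.inr i) (Sum.inl 0) x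
      = X.W (space x) * pd i (gradient X.h X.W i) (space x)
        + ∑ k, christoffel X.h i i k (space x)
          * (X.W (space x) * gradient X.h X.W k (space x)) := by
    intro i
    rw [riemann, h1, h2]
    simp [hX.christoffel_inl_inl_inl hΩ hx, hX.christoffel_inr_inl_inl hΩ hx,
      hX.christoffel_inl_inr_inl hΩ hx, hX.christoffel_inr_inl_inr hΩ hx,
      hX.christoffel_inr_inr_inr hΩ hx, hX.christoffel_inr_inr_inl hΩ hx]
    field_simp
    ring
  have h4 : riemann X.metric (Sum.inl 0) (Sum.inl 0) (Sum.inl 0) (Sum.inl 0) x = 0 := by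
    simp [riemann]
  simp only [ricci, Fintype.sum_sum_type, Finset.univ_unique, Finset.sum_singleton,
    Fin.default_eq_zero, h3, h4, zero_add, divergence, Finset.sum_add_distrib, mul_add,
    Finset.mul_sum, Finset.sum_mul]
  congr 1
  rw [Finset.sum_comm]
  refine Finset.sum_congr rfl fun i _ => Finset.sum_congr rfl fun k _ => ?_
  ring

end IsEinsteinMaxwell

end StaticFluid

end EMFluid

end

/-! ### Electrostatic field, its stress-energy, and the mixed Einstein tensor. -/

noncomputable section

namespace EMFluid

theorem sphereArea_pos {n : ℕ} (hn : 0 < n) : 0 < sphereArea n := by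
  have h : (0 : ℝ) < (n : ℝ) / 2 := by positivity
  have := Real.Gamma_pos_of_pos h
  unfold sphereArea
  positivity

namespace StaticFluid

variable {n : ℕ} {X : StaticFluid n} {G : ℝ} {Ω : Set (Fin n → ℝ)} {x : Index n → ℝ}

/-- The squared norm `h^{ij} ∂_i φ ∂_j φ` of the gradient of the potential. -/
def gradSq (X : StaticFluid n) (y : Fin n → ℝ) : ℝ :=
  ∑ i, gradient X.h X.φ i y * pd i X.φ y

theorem ρem_eq (y : Fin n → ℝ) :
    X.ρem y = 1 / sphereArea n * (X.gradSq y / X.W y ^ 2) := by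
  rw [ρem, gradSq]
  congr 2
  refine Finset.sum_congr rfl fun i _ => ?_
  rw [gradient, Finset.sum_mul]
  exact Finset.sum_congr rfl fun j _ => by ring

theorem maxwellTensor_inl_inl (a b : Fin 1) (x : Index n → ℝ) :
    maxwellTensor X.gauge (Sum.inl a) (Sum.inl b) x = 0 := by
  rw [Subsingleton.elim a b, maxwellTensor, sub_self]

theorem maxwellTensor_inr_inr (i j : Fin n) (x : Index n → ℝ) :
    maxwellTensor X.gauge (Sum.inr i) (Sum.inr j) x = 0 := by
  simp [maxwellTensor, gauge, pd_const]

theorem metric_inl_inl (a b : Fin 1) (x : Index n → ℝ) :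
    X.metric x (Sum.inl a) (Sum.inl b) = -X.W (space x) ^ 2 := rfl

theorem metric_inl_inr (a : Fin 1) (i : Fin n) (x : Index n → ℝ) :
    X.metric x (Sum.inl a) (Sum.inr i) = 0 := rfl

theorem metric_inr_inl (a : Fin 1) (i : Fin n) (x : Index n → ℝ) :
    X.metric x (Sum.inr i) (Sum.inl a) = 0 := rfl

theorem metric_inr_inr (i j : Fin n) (x : Index n → ℝ) :
    X.metric x (Sum.inr i) (Sum.inr j) = X.h (space x) i j := rfl

namespace IsEinsteinMaxwell

theorem maxwellTensor_inl_inr (hX : X.IsEinsteinMaxwell G Ω) (hΩ : IsOpen Ω) (hx : space x ∈ Ω)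
    (a : Fin 1) (i : Fin n) :
    maxwellTensor X.gauge (Sum.inl a) (Sum.inr i) x = pd i X.φ (space x) := by
  simp [maxwellTensor, gauge, pd_const, pd_neg, pd_space (hX.diff_φ hΩ hx)]

theorem maxwellTensor_inr_inl (hX : X.IsEinsteinMaxwell G Ω) (hΩ : IsOpen Ω) (hx : space x ∈ Ω)
    (a : Fin 1) (i : Fin n) :
    maxwellTensor X.gauge (Sum.inr i) (Sum.inl a) x = -pd i X.φ (space x) := by
  simp [maxwellTensor, gauge, pd_const, pd_neg, pd_space (hX.diff_φ hΩ hx)]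

theorem maxwellTensorUp_inl_inl (hX : X.IsEinsteinMaxwell G Ω) (hx : space x ∈ Ω)
    (a b : Fin 1) : maxwellTensorUp X.metric X.gauge (Sum.inl a) (Sum.inl b) x = 0 := by
  simp [maxwellTensorUp, hX.metric_inv hx, maxwellTensor_inl_inl]

theorem maxwellTensorUp_inr_inr (hX : X.IsEinsteinMaxwell G Ω) (hx : space x ∈ Ω)
    (i j : Fin n) : maxwellTensorUp X.metric X.gauge (Sum.inr i) (Sum.inr j) x = 0 := by
  simp [maxwellTensorUp, hX.metric_inv hx, maxwellTensor_inr_inr]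

theorem maxwellTensorUp_inl_inr (hX : X.IsEinsteinMaxwell G Ω) (hΩ : IsOpen Ω)
    (hx : space x ∈ Ω) (a : Fin 1) (i : Fin n) :
    maxwellTensorUp X.metric X.gauge (Sum.inl a) (Sum.inr i) x
      = -(gradient X.h X.φ i (space x) / X.W (space x) ^ 2) := by
  simp [maxwellTensorUp, hX.metric_inv hx, hX.maxwellTensor_inl_inr hΩ hx, gradient,
    Finset.sum_div]
  refine Finset.sum_congr rfl fun j _ => ?_
  ring

theorem maxwellTensorUp_inr_inl (hX : X.IsEinsteinMaxwell G Ω) (hΩ : IsOpen Ω)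
    (hx : space x ∈ Ω) (a : Fin 1) (i : Fin n) :
    maxwellTensorUp X.metric X.gauge (Sum.inr i) (Sum.inl a) x
      = gradient X.h X.φ i (space x) / X.W (space x) ^ 2 := by
  simp [maxwellTensorUp, hX.metric_inv hx, hX.maxwellTensor_inr_inl hΩ hx, gradient,
    Finset.sum_div]
  refine Finset.sum_congr rfl fun j _ => ?_
  ring

/-- `F_{ρσ} F^{ρσ} = -2 (∇φ)² / W²`. -/
theorem maxwell_sq (hX : X.IsEinsteinMaxwell G Ω) (hΩ : IsOpen Ω) (hx : space x ∈ Ω) :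
    ∑ ρ, ∑ σ, maxwellTensor X.gauge ρ σ x * maxwellTensorUp X.metric X.gauge ρ σ x
      = -2 * (X.gradSq (space x) / X.W (space x) ^ 2) := by
  simp only [Fintype.sum_sum_type, Finset.univ_unique, Finset.sum_singleton,
    Fin.default_eq_zero, maxwellTensor_inl_inl, maxwellTensor_inr_inr,
    hX.maxwellTensor_inl_inr hΩ hx, hX.maxwellTensor_inr_inl hΩ hx,
    hX.maxwellTensorUp_inl_inr hΩ hx, hX.maxwellTensorUp_inr_inl hΩ hx, zero_mul, zero_add,
    Finset.sum_const_zero, add_zero, gradSq, Finset.sum_div, Finset.mul_sum,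
    ← Finset.sum_add_distrib]
  refine Finset.sum_congr rfl fun j _ => ?_
  ring

theorem emTensor_inl_inl (hX : X.IsEinsteinMaxwell G Ω) (hΩ : IsOpen Ω) (hx : space x ∈ Ω)
    (S : ℝ) : emTensor S X.metric X.gauge (Sum.inl 0) (Sum.inl 0) x
      = 1 / S * (1 / 2 * X.gradSq (space x)) := by
  have hW := (hX.W_pos _ hx).ne'
  have h1 : ∑ ρ, ∑ σ, (X.metric x)⁻¹ ρ σ * maxwellTensor X.gauge (Sum.inl 0) σ x
      * maxwellTensor X.gauge (Sum.inl 0) ρ x = X.gradSq (space x) := by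
    simp [hX.metric_inv hx, maxwellTensor_inl_inl, hX.maxwellTensor_inl_inr hΩ hx, gradSq,
      gradient, Finset.sum_mul]
  rw [emTensor, h1, hX.maxwell_sq hΩ hx]
  simp only [metric, Matrix.fromBlocks_apply₁₁, Matrix.of_apply]
  congr 1
  field_simp
  ring

theorem emTensor_inr_inr (hX : X.IsEinsteinMaxwell G Ω) (hΩ : IsOpen Ω) (hx : space x ∈ Ω)
    (S : ℝ) (i j : Fin n) : emTensor S X.metric X.gauge (Sum.inr i) (Sum.inr j) x
      = 1 / S * (-(pd i X.φ (space x) * pd j X.φ (space x) / X.W (space x) ^ 2)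
        + 1 / 2 * X.h (space x) i j * (X.gradSq (space x) / X.W (space x) ^ 2)) := by
  have hW := (hX.W_pos _ hx).ne'
  have h1 : ∑ ρ, ∑ σ, (X.metric x)⁻¹ ρ σ * maxwellTensor X.gauge (Sum.inr i) σ x
      * maxwellTensor X.gauge (Sum.inr j) ρ x
      = -(pd i X.φ (space x) * pd j X.φ (space x) / X.W (space x) ^ 2) := by
    simp [hX.metric_inv hx, maxwellTensor_inr_inr, hX.maxwellTensor_inr_inl hΩ hx]
    ring
  rw [emTensor, h1, hX.maxwell_sq hΩ hx]
  simp only [metric, Matrix.fromBlocks_apply₂₂]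
  congr 1
  ring

theorem emTensor_inl_inr (hX : X.IsEinsteinMaxwell G Ω) (hx : space x ∈ Ω)
    (S : ℝ) (a : Fin 1) (i : Fin n) :
    emTensor S X.metric X.gauge (Sum.inl a) (Sum.inr i) x = 0 := by
  simp [emTensor, hX.metric_inv hx, maxwellTensor_inl_inl, maxwellTensor_inr_inr,
    metric_inl_inr]

theorem emTensor_inr_inl (hX : X.IsEinsteinMaxwell G Ω) (hx : space x ∈ Ω)
    (S : ℝ) (a : Fin 1) (i : Fin n) :
    emTensor S X.metric X.gauge (Sum.inr i) (Sum.inl a) x = 0 := by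
  simp [emTensor, hX.metric_inv hx, maxwellTensor_inl_inl, maxwellTensor_inr_inr,
    metric_inr_inl]

end IsEinsteinMaxwell

/-- The gravitational coupling `(d-2)/(d-3) S_{d-2} G`. -/
def coupling (n : ℕ) (G : ℝ) : ℝ := ((n : ℝ) - 1) / ((n : ℝ) - 2) * sphereArea n * G

/-- The spatial stress `T^i_j + E^i_j`. -/
def spatialStress (X : StaticFluid n) (i j : Fin n) (y : Fin n → ℝ) : ℝ :=
  (X.p y + 1 / sphereArea n * (1 / 2 * (X.gradSq y / X.W y ^ 2))) * (1 : Matrix _ _ ℝ) i j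
    - 1 / sphereArea n * (gradient X.h X.φ i y * pd j X.φ y / X.W y ^ 2)

/-- The energy density `-(T^0_0 + E^0_0)`. -/
def energyDensity (X : StaticFluid n) (y : Fin n → ℝ) : ℝ :=
  X.ρm y + 1 / sphereArea n * (1 / 2 * (X.gradSq y / X.W y ^ 2))

namespace IsEinsteinMaxwell

theorem einsteinMixed_inl_inl (hX : X.IsEinsteinMaxwell G Ω) (hΩ : IsOpen Ω)
    (hx : space x ∈ Ω) :
    einsteinMixed X.metric (Sum.inl 0) (Sum.inl 0) x
      = coupling n G * -X.energyDensity (space x) := by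
  have hW := (hX.W_pos _ hx).ne'
  simp only [einsteinMixed, hX.einstein x hx, Fintype.sum_sum_type, Finset.univ_unique,
    Finset.sum_singleton, Fin.default_eq_zero, hX.metric_inv hx, Matrix.fromBlocks_apply₁₁,
    Matrix.fromBlocks_apply₁₂, Matrix.zero_apply, zero_mul, Finset.sum_const_zero, add_zero,
    hX.emTensor_inl_inl hΩ hx, fluidTensor, velocity, Sum.elim_inl, metric_inl_inl, Matrix.of_apply,
    energyDensity, coupling]
  field_simp
  ring

theorem einsteinMixed_inl_inr (hX : X.IsEinsteinMaxwell G Ω) (hx : space x ∈ Ω) (a : Fin 1)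
    (i : Fin n) : einsteinMixed X.metric (Sum.inl a) (Sum.inr i) x = 0 := by
  simp [einsteinMixed, hX.einstein x hx, hX.metric_inv hx, hX.emTensor_inl_inr hx, fluidTensor,
    velocity, metric_inl_inr]

theorem einsteinMixed_inr_inl (hX : X.IsEinsteinMaxwell G Ω) (hx : space x ∈ Ω) (a : Fin 1)
    (i : Fin n) : einsteinMixed X.metric (Sum.inr i) (Sum.inl a) x = 0 := by
  simp [einsteinMixed, hX.einstein x hx, hX.metric_inv hx, hX.emTensor_inr_inl hx, fluidTensor,
    velocity, metric_inr_inl]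

/-- Raising one index with h⁻¹ turns h_{kj} into δ^i_j and ∂_k φ into ∇^i φ. This gives the Einstein
tensor a form whose divergence can be computed from the matter fields. -/
theorem einsteinMixed_inr_inr (hX : X.IsEinsteinMaxwell G Ω) (hΩ : IsOpen Ω)
    (hx : space x ∈ Ω) (i j : Fin n) :
    einsteinMixed X.metric (Sum.inr i) (Sum.inr j) x
      = coupling n G * X.spatialStress i j (space x) := by
  have h1 : (1 : Matrix _ _ ℝ) i j = ∑ k, (X.h (space x))⁻¹ i k * X.h (space x) k j := by
    rw [← (hX.spatial hΩ).inv_mul hx, Matrix.mul_apply]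
  have h2 : gradient X.h X.φ i (space x)
      = ∑ k, (X.h (space x))⁻¹ i k * pd k X.φ (space x) := rfl
  rw [spatialStress, h1, h2, einsteinMixed]
  simp only [hX.einstein x hx, Fintype.sum_sum_type, Finset.univ_unique,
    Finset.sum_singleton, Fin.default_eq_zero, hX.metric_inv hx, Matrix.fromBlocks_apply₂₂,
    Matrix.fromBlocks_apply₂₁, Matrix.zero_apply, zero_mul, zero_add,
    hX.emTensor_inr_inr hΩ hx, fluidTensor, velocity, Sum.elim_inr, metric_inr_inr, coupling]
  rw [Finset.mul_sum, Finset.sum_mul, Finset.sum_div, Finset.mul_sum, ← Finset.sum_sub_distrib,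
    Finset.mul_sum]
  refine Finset.sum_congr rfl fun k _ => ?_
  ring

end IsEinsteinMaxwell

end StaticFluid

end EMFluid

end

/-! ### Gauss' law, the equation for the Laplacian of W, and hydrostatic equilibrium. -/

noncomputable section

namespace EMFluid

section SpatialOperators

variable {ι : Type*} [Fintype ι] [DecidableEq ι] {h : (ι → ℝ) → Matrix ι ι ℝ} {Ω : Set (ι → ℝ)}
  {y : ι → ℝ}

theorem divergence_congr (hΩ : IsOpen Ω) (hy : y ∈ Ω) {V V' : ι → (ι → ℝ) → ℝ}
    (hV : ∀ z ∈ Ω, ∀ i, V i z = V' i z) : divergence h V y = divergence h V' y := by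
  refine Finset.sum_congr rfl fun i _ => ?_
  rw [pd_congr i hΩ hy fun z hz => hV z hz i, hV y hy i]

theorem divergence_mul {f : (ι → ℝ) → ℝ} {V : ι → (ι → ℝ) → ℝ} (hf : DifferentiableAt ℝ f y)
    (hV : ∀ i, DifferentiableAt ℝ (V i) y) :
    divergence h (fun i z => f z * V i z) y
      = f y * divergence h V y + ∑ i, pd i f y * V i y := by
  simp only [divergence]
  rw [Finset.mul_sum, ← Finset.sum_add_distrib]
  refine Finset.sum_congr rfl fun i _ => ?_
  rw [pd_mul i hf (hV i)]; ring

/-- The derivative of the squared norm of a gradient. -/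
theorem pd_gradient_sq (hh : IsMetricOn h Ω) (hy : y ∈ Ω) {f : (ι → ℝ) → ℝ}
    (hf : ContDiffOn ℝ ∞ f Ω) (j : ι) :
    pd j (fun z => ∑ i, gradient h f i z * pd i f z) y
      = 2 * ∑ i, gradient h f i y * pd j (pd i f) y
        - 2 * ∑ i, ∑ k, christoffel h i j k y * gradient h f k y * pd i f y := by
  have hd := fun i => differentiableAt_of_contDiffOn hh.isOpen hy (contDiffOn_pd i hh.isOpen hf)
  have hk := fun i k => differentiableAt_of_contDiffOn hh.isOpen hy (hh.smooth_inv i k)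
  have hg := fun i => differentiableAt_of_contDiffOn hh.isOpen hy (contDiffOn_gradient hh hf i)
  have hinv : ∀ i k, pd j (fun z => (h z)⁻¹ i k) y
      = -(∑ l, christoffel h i j l y * (h y)⁻¹ l k + ∑ l, (h y)⁻¹ i l * christoffel h k j l y) :=
    fun i k => by
      have := congrFun (congrFun (hh.matPd_inv_metric hy j) i) k
      simpa [matPd, connection, Matrix.mul_apply] using this
  -- The derivative of h⁻¹ produces two Christoffel terms. After contraction with ∂_i f they are
  -- equal (`h3`, `h4`), whence the factor 2 in the result.
  have hgrad : ∀ i, pd j (gradient h f i) y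
      = ∑ k, (h y)⁻¹ i k * pd j (pd k f) y - ∑ l, christoffel h i j l y * gradient h f l y
        - ∑ k, ∑ l, (h y)⁻¹ i l * christoffel h k j l y * pd k f y := by
    intro i
    have h1 : ∑ l, christoffel h i j l y * gradient h f l y
        = ∑ k, ∑ l, christoffel h i j l y * (h y)⁻¹ l k * pd k f y := by
      rw [Finset.sum_comm]
      refine Finset.sum_congr rfl fun l _ => ?_
      rw [gradient, Finset.mul_sum]
      exact Finset.sum_congr rfl fun k _ => by ring
    rw [h1]
    unfold gradient
    rw [pd_sum (f := fun k z => (h z)⁻¹ i k * pd k f z) j fun k _ => (hk i k).mul (hd k),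
      ← Finset.sum_sub_distrib, ← Finset.sum_sub_distrib]
    refine Finset.sum_congr rfl fun k _ => ?_
    rw [pd_mul j (hk i k) (hd k), hinv, ← Finset.sum_mul, ← Finset.sum_mul]
    ring
  have h2 : ∑ i, (∑ k, (h y)⁻¹ i k * pd j (pd k f) y) * pd i f y
      = ∑ i, gradient h f i y * pd j (pd i f) y := by
    simp only [gradient, Finset.sum_mul]
    rw [Finset.sum_comm]
    refine Finset.sum_congr rfl fun i _ => Finset.sum_congr rfl fun k _ => ?_
    rw [hh.inv_symm hy k i]; ring
  have h3 : ∑ i, (∑ l, christoffel h i j l y * gradient h f l y) * pd i f y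
      = ∑ i, ∑ k, christoffel h i j k y * gradient h f k y * pd i f y := by
    simp only [Finset.sum_mul]
  have h4 : ∑ i, (∑ k, ∑ l, (h y)⁻¹ i l * christoffel h k j l y * pd k f y) * pd i f y
      = ∑ i, ∑ k, christoffel h i j k y * gradient h f k y * pd i f y := by
    simp only [Finset.sum_mul, gradient, Finset.mul_sum]
    rw [Finset.sum_comm]
    refine Finset.sum_congr rfl fun k _ => ?_
    rw [Finset.sum_comm]
    refine Finset.sum_congr rfl fun l _ => Finset.sum_congr rfl fun i _ => ?_
    rw [hh.inv_symm hy i l]; ring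
  rw [pd_sum (f := fun i z => gradient h f i z * pd i f z) j fun i _ => (hg i).mul (hd i)]
  have h5 : ∀ i, pd j (fun z => gradient h f i z * pd i f z) y
      = (∑ k, (h y)⁻¹ i k * pd j (pd k f) y) * pd i f y
        - (∑ l, christoffel h i j l y * gradient h f l y) * pd i f y
        - (∑ k, ∑ l, (h y)⁻¹ i l * christoffel h k j l y * pd k f y) * pd i f y
        + gradient h f i y * pd j (pd i f) y := fun i => by
    rw [pd_mul j (hg i) (hd i), hgrad]; ring
  simp only [h5, Finset.sum_add_distrib, Finset.sum_sub_distrib, h2, h3, h4]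
  ring

end SpatialOperators

namespace StaticFluid

variable {n : ℕ} {X : StaticFluid n} {G : ℝ} {Ω : Set (Fin n → ℝ)} {y : Fin n → ℝ}

/-- The event at time zero with given spatial coordinates. -/
def event (y : Fin n → ℝ) : Index n → ℝ := Sum.elim 0 y

/-- The electric field `∇^i φ / W²`. -/
def electric (X : StaticFluid n) (i : Fin n) (y : Fin n → ℝ) : ℝ :=
  gradient X.h X.φ i y / X.W y ^ 2

namespace IsEinsteinMaxwell

theorem contDiffOn_electric (hX : X.IsEinsteinMaxwell G Ω) (hΩ : IsOpen Ω) (i : Fin n) :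
    ContDiffOn ℝ ∞ (X.electric i) Ω :=
  (contDiffOn_gradient (hX.spatial hΩ) hX.smooth_φ i).div (hX.smooth_W.pow 2)
    fun z hz => pow_ne_zero 2 (hX.W_pos z hz).ne'

theorem contDiffOn_gradSq (hX : X.IsEinsteinMaxwell G Ω) (hΩ : IsOpen Ω) :
    ContDiffOn ℝ ∞ X.gradSq Ω :=
  ContDiffOn.sum fun i _ => (contDiffOn_gradient (hX.spatial hΩ) hX.smooth_φ i).mul
    (contDiffOn_pd i hΩ hX.smooth_φ)

/-- Gauss' law. -/
theorem gauss_law (hX : X.IsEinsteinMaxwell G Ω) (hΩ : IsOpen Ω) (hy : y ∈ Ω) :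
    divergence X.h X.electric y + ∑ i, pd i X.W y / X.W y * X.electric i y
      = -(sphereArea n * X.ρe y / X.W y) := by
  have hx : space (event y) ∈ Ω := hy
  have hW := (hX.W_pos _ hy).ne'
  have hg := hX.spacetime hΩ
  have h1 : ∀ i, pd (Sum.inr i) (maxwellTensorUp X.metric X.gauge (Sum.inl 0) (Sum.inr i))
      (event y) = -pd i (X.electric i) y := by
    intro i
    rw [pd_congr _ hg.isOpen hx fun z hz => hX.maxwellTensorUp_inl_inr hΩ hz 0 i, pd_neg]
    congr 1
    exact pd_space (f := X.electric i) (x := event y)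
      (differentiableAt_of_contDiffOn hΩ hy (hX.contDiffOn_electric hΩ i)) i
  have h2 : pd (Sum.inl 0) (maxwellTensorUp X.metric X.gauge (Sum.inl 0) (Sum.inl 0))
      (event y) = 0 := by
    rw [pd_congr _ hg.isOpen hx fun z hz => hX.maxwellTensorUp_inl_inl hz 0 0, pd_const]
  have hs : space (event y) = y := rfl
  have hmax := hX.maxwell (event y) hx (Sum.inl 0)
  simp only [maxwellDivergence, current, Fintype.sum_sum_type, Finset.univ_unique,
    Finset.sum_singleton, Fin.default_eq_zero, h1, h2, hX.maxwellTensorUp_inl_inl hx,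
    hX.maxwellTensorUp_inr_inr hx,
    hX.maxwellTensorUp_inl_inr hΩ hx, hX.maxwellTensorUp_inr_inl hΩ hx,
    hX.christoffel_inl_inl_inl hΩ hx, hX.christoffel_inl_inl_inr hΩ hx,
    hX.christoffel_inl_inr_inl hΩ hx, hX.christoffel_inr_inr_inr hΩ hx,
    hX.christoffel_inl_inr_inr hΩ hx, hX.metric_inv hx, Matrix.fromBlocks_apply₁₁,
    Matrix.fromBlocks_apply₁₂, Matrix.zero_apply, zero_mul, mul_zero, add_zero, zero_add,
    Finset.sum_const_zero, velocity, Sum.elim_inl, Matrix.of_apply, hs, mul_neg,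
    Finset.sum_add_distrib, Finset.sum_neg_distrib] at hmax
  have h3 : ∑ i, ∑ k, christoffel X.h i i k y * (gradient X.h X.φ k y / X.W y ^ 2)
      = ∑ i, (∑ k, christoffel X.h k k i y) * X.electric i y := by
    rw [Finset.sum_comm]
    exact Finset.sum_congr rfl fun i _ => by rw [Finset.sum_mul]; rfl
  rw [h3] at hmax
  have h4 : sphereArea n * (-(X.W y ^ 2)⁻¹ * -(X.ρe y * X.W y)) = sphereArea n * X.ρe y / X.W y := by
    field_simp
  have h5 : ∑ i, pd i X.W y / X.W y * (gradient X.h X.φ i y / X.W y ^ 2)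
      = ∑ i, pd i X.W y / X.W y * X.electric i y := rfl
  rw [divergence, Finset.sum_add_distrib, ← h5]
  linarith

/-- Gauss' law as a divergence: `∇_i (∇^i φ / W) = -S ρ_e`. -/
theorem divergence_gradient_φ (hX : X.IsEinsteinMaxwell G Ω) (hΩ : IsOpen Ω) (hy : y ∈ Ω) :
    divergence X.h (fun i z => gradient X.h X.φ i z / X.W z) y = -(sphereArea n * X.ρe y) := by
  have hW := (hX.W_pos _ hy).ne'
  -- Since ∇φ/W is W times the electric field ∇φ/W², the product rule yields the ∇W term of
  -- `gauss_law`.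
  rw [divergence_congr (V' := fun i z => X.W z * X.electric i z) hΩ hy fun z hz i => by
      have := (hX.W_pos _ hz).ne'
      rw [electric]; field_simp,
    divergence_mul (hX.diff_W hΩ hy) fun i =>
      differentiableAt_of_contDiffOn hΩ hy (hX.contDiffOn_electric hΩ i)]
  have h1 := hX.gauss_law hΩ hy
  have h2 : ∑ i, pd i X.W y * X.electric i y
      = X.W y * ∑ i, pd i X.W y / X.W y * X.electric i y := by
    rw [Finset.mul_sum]
    exact Finset.sum_congr rfl fun i _ => by field_simp
  rw [h2, ← mul_add, h1]
  field_simp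

/-- The time-time component of the Einstein equations:
`∇² W = S G W (ρ_m + ((d-1)/(d-3)) p + ρ_em)`. -/
theorem laplacian_W (hn : 3 ≤ n) (hX : X.IsEinsteinMaxwell G Ω) (hΩ : IsOpen Ω) (hy : y ∈ Ω) :
    divergence X.h (gradient X.h X.W) y
      = sphereArea n * G * X.W y * (X.ρm y + n / ((n : ℝ) - 2) * X.p y + X.ρem y) := by
  have hx : space (event y) ∈ Ω := hy
  have hs : space (event y) = y := rfl
  have hW := (hX.W_pos _ hy).ne'
  have hg := hX.spacetime hΩ
  have hn' : (3 : ℝ) ≤ n := by exact_mod_cast hn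
  have hn1 : (n : ℝ) - 1 ≠ 0 := by linarith
  have hn2 : (n : ℝ) - 2 ≠ 0 := by linarith
  have hS := (sphereArea_pos (n := n) (by omega)).ne'
  -- The trace of the Einstein tensor in dimension n + 1 expresses R through the matter fields, so
  -- that R can be eliminated from the time-time equation.
  have htr : ∑ c, einsteinMixed X.metric c c (event y)
      = (1 - ((n : ℝ) + 1) / 2) * scalarCurvature X.metric (event y) := by
    simp only [hg.einsteinMixed_eq (x := event y) hx, Finset.sum_sub_distrib,
      ← hg.scalarCurvature_eq (x := event y) hx, Matrix.one_apply_eq, one_mul, Finset.sum_const,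
      Finset.card_univ, Fintype.card_sum, Fintype.card_fin, nsmul_eq_mul]
    push_cast
    ring
  have hst : ∑ i, X.spatialStress i i y
      = n * (X.p y + 1 / 2 * X.ρem y) - X.ρem y := by
    simp only [spatialStress, Finset.sum_sub_distrib, Matrix.one_apply_eq, mul_one,
      Finset.sum_const, Finset.card_univ, Fintype.card_fin, nsmul_eq_mul, ← Finset.mul_sum,
      ← Finset.sum_div, ρem_eq]
    rw [gradSq]; ring
  rw [Fintype.sum_sum_type] at htr
  simp only [Finset.univ_unique, Finset.sum_singleton, Fin.default_eq_zero,
    hX.einsteinMixed_inl_inl hΩ hx, hX.einsteinMixed_inr_inr hΩ hx, hs, ← Finset.mul_sum,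
    hst] at htr
  have h00 := hX.einstein (event y) hx (Sum.inl 0) (Sum.inl 0)
  rw [einsteinTensor, hX.ricci_inl_inl hΩ hx, hX.emTensor_inl_inl hΩ hx, fluidTensor,
    metric_inl_inl, hs] at h00
  simp only [velocity, Sum.elim_inl, hs] at h00
  have hen : X.energyDensity y = X.ρm y + 1 / 2 * X.ρem y := by
    rw [energyDensity, ρem_eq]; ring
  have hgs : 1 / sphereArea n * (1 / 2 * X.gradSq y) = 1 / 2 * X.W y ^ 2 * X.ρem y := by
    rw [ρem_eq]; field_simp
  rw [hgs] at h00
  rw [hen, coupling] at htr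
  generalize scalarCurvature X.metric (event y) = R at htr h00
  generalize divergence X.h (gradient X.h X.W) y = D at h00 ⊢
  generalize X.ρem y = e at *
  have hR : R = -2 / ((n : ℝ) - 1) * (((n : ℝ) - 1) / ((n : ℝ) - 2) * sphereArea n * G *
      (-(X.ρm y + 1 / 2 * e) + (n * (X.p y + 1 / 2 * e) - e))) := by
    field_simp
    field_simp at htr
    apply mul_left_cancel₀ hn1
    linear_combination htr
  rw [hR] at h00
  have hD : X.W y * D = X.W y *
      (sphereArea n * G * X.W y * (X.ρm y + n / ((n : ℝ) - 2) * X.p y + e)) := by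
    field_simp
    field_simp at h00
    linarith
  exact mul_left_cancel₀ hW hD

theorem contDiffOn_spatialStress (hX : X.IsEinsteinMaxwell G Ω) (hΩ : IsOpen Ω) (i j : Fin n) :
    ContDiffOn ℝ ∞ (X.spatialStress i j) Ω := by
  have h2 : ∀ z ∈ Ω, X.W z ^ 2 ≠ 0 := fun z hz => pow_ne_zero 2 (hX.W_pos z hz).ne'
  exact ((hX.smooth_p.add (contDiffOn_const.mul (contDiffOn_const.mul
    ((hX.contDiffOn_gradSq hΩ).div (hX.smooth_W.pow 2) h2)))).mul contDiffOn_const).sub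
    (contDiffOn_const.mul (((contDiffOn_gradient (hX.spatial hΩ) hX.smooth_φ i).mul
      (contDiffOn_pd j hΩ hX.smooth_φ)).div (hX.smooth_W.pow 2) h2))

/-- Conservation of the total stress, from the contracted Bianchi identity. -/
theorem stress_conservation (hn : 3 ≤ n) (hG : 0 < G) (hX : X.IsEinsteinMaxwell G Ω)
    (hΩ : IsOpen Ω) (hy : y ∈ Ω) (j : Fin n) :
    ∑ i, pd i (X.spatialStress i j) y
      + ∑ i, (pd i X.W y / X.W y + ∑ k, christoffel X.h k k i y) * X.spatialStress i j y
      + pd j X.W y / X.W y * X.energyDensity y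
      - ∑ i, ∑ k, christoffel X.h i j k y * X.spatialStress k i y = 0 := by
  have hx : space (event y) ∈ Ω := hy
  have hs : space (event y) = y := rfl
  have hg := hX.spacetime hΩ
  have hn' : (3 : ℝ) ≤ n := by exact_mod_cast hn
  -- A nonzero coupling can be divided out, so conservation passes from the Einstein tensor to the
  -- total stress.
  have hκ : coupling n G ≠ 0 := by
    have h1 : (0 : ℝ) < (n : ℝ) - 1 := by linarith
    have h2 : (0 : ℝ) < (n : ℝ) - 2 := by linarith
    have := sphereArea_pos (n := n) (by omega)
    unfold coupling; positivity
  have h1 : ∀ i, pd (Sum.inr i) (einsteinMixed X.metric (Sum.inr i) (Sum.inr j)) (event y)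
      = coupling n G * pd i (X.spatialStress i j) y := by
    intro i
    have hd := differentiableAt_of_contDiffOn hΩ hy (hX.contDiffOn_spatialStress hΩ i j)
    rw [pd_congr _ hg.isOpen hx fun z hz => hX.einsteinMixed_inr_inr hΩ hz i j]
    have := pd_space (f := fun z => coupling n G * X.spatialStress i j z) (x := event y)
      (hd.const_mul _) i
    rw [this, hs, pd_mul i (differentiableAt_const _) hd, pd_const]
    ring
  have h2 : pd (Sum.inl 0) (einsteinMixed X.metric (Sum.inl 0) (Sum.inr j)) (event y) = 0 := by
    rw [pd_congr _ hg.isOpen hx fun z hz => hX.einsteinMixed_inl_inr hz 0 j, pd_const]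
  have hB := hg.mixedDivergence_einstein (x := event y) hx (Sum.inr j)
  simp only [mixedDivergence, Fintype.sum_sum_type, Finset.univ_unique,
    Finset.sum_singleton, Fin.default_eq_zero, h1, h2, hX.einsteinMixed_inl_inl hΩ hx,
    hX.einsteinMixed_inl_inr hx, hX.einsteinMixed_inr_inl hx, hX.einsteinMixed_inr_inr hΩ hx,
    hX.christoffel_inl_inl_inr hΩ hx,
    hX.christoffel_inl_inr_inl hΩ hx, hX.christoffel_inr_inr_inr hΩ hx,
    mul_zero, add_zero, zero_add, Finset.sum_const_zero, hs] at hB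
  apply mul_left_cancel₀ hκ
  rw [mul_zero, ← hB]
  have h3 : ∑ i, ∑ k, christoffel X.h i i k y * (coupling n G * X.spatialStress k j y)
      = coupling n G * ∑ i, (∑ k, christoffel X.h k k i y) * X.spatialStress i j y := by
    rw [Finset.sum_comm, Finset.mul_sum]
    refine Finset.sum_congr rfl fun i _ => ?_
    rw [Finset.sum_mul, Finset.mul_sum]
    exact Finset.sum_congr rfl fun k _ => by ring
  have h4 : ∑ i, pd i X.W y / X.W y * (coupling n G * X.spatialStress i j y)
      = coupling n G * ∑ i, pd i X.W y / X.W y * X.spatialStress i j y := by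
    rw [Finset.mul_sum]
    exact Finset.sum_congr rfl fun k _ => by ring
  have h5 : ∑ i, ∑ k, christoffel X.h i j k y * (coupling n G * X.spatialStress k i y)
      = coupling n G * ∑ i, ∑ k, christoffel X.h i j k y * X.spatialStress k i y := by
    simp only [Finset.mul_sum]
    exact Finset.sum_congr rfl fun i _ => Finset.sum_congr rfl fun k _ => by ring
  simp only [h3, h4, h5, ← Finset.mul_sum, add_mul, Finset.sum_add_distrib]
  ring

/-- Hydrostatic equilibrium. -/
theorem euler (hn : 3 ≤ n) (hG : 0 < G) (hX : X.IsEinsteinMaxwell G Ω)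
    (hΩ : IsOpen Ω) (hy : y ∈ Ω) (j : Fin n) :
    X.W y * pd j X.p y + (X.ρm y + X.p y) * pd j X.W y + X.ρe y * pd j X.φ y = 0 := by
  have hW := (hX.W_pos _ hy).ne'
  have hh := hX.spatial hΩ
  have hS := (sphereArea_pos (n := n) (by omega)).ne'
  have hB := hX.stress_conservation hn hG hΩ hy j
  have hgl := hX.gauss_law hΩ hy
  have hdV := fun i => differentiableAt_of_contDiffOn hΩ hy (hX.contDiffOn_electric hΩ i)
  have hdφ := fun i => differentiableAt_of_contDiffOn hΩ hy (contDiffOn_pd i hΩ hX.smooth_φ)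
  have hdW := hX.diff_W hΩ hy
  have hdp := hX.diff_p hΩ hy
  -- The isotropic part of the stress: fluid pressure plus half the electromagnetic energy density.
  -- The rest is the tensor product of the electric field with dφ.
  set a : (Fin n → ℝ) → ℝ :=
    fun z => X.p z + 1 / sphereArea n * (1 / 2 * (X.gradSq z / X.W z ^ 2)) with ha
  have hT : ∀ i k z, X.spatialStress i k z
      = a z * (1 : Matrix _ _ ℝ) i k - 1 / sphereArea n * (X.electric i z * pd k X.φ z) := by
    intro i k z
    rw [spatialStress, electric]; ring
  have hdu : DifferentiableAt ℝ (fun z => X.gradSq z / X.W z ^ 2) y :=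
    differentiableAt_of_contDiffOn hΩ hy ((hX.contDiffOn_gradSq hΩ).div (hX.smooth_W.pow 2)
      fun z hz => pow_ne_zero 2 (hX.W_pos z hz).ne')
  have hu : pd j (fun z => X.gradSq z / X.W z ^ 2) y
      = pd j X.gradSq y / X.W y ^ 2 - 2 * pd j X.W y / X.W y * (X.gradSq y / X.W y ^ 2) := by
    have h1 : pd j X.gradSq y = pd j (fun z => X.gradSq z / X.W z ^ 2 * (X.W z * X.W z)) y :=
      pd_congr j hΩ hy fun z hz => by
        have := (hX.W_pos _ hz).ne'
        field_simp
    rw [pd_mul j hdu (hdW.fun_mul hdW), pd_mul j hdW hdW] at h1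
    rw [h1]
    field_simp
    ring
  have hda : DifferentiableAt ℝ a y := hdp.add ((hdu.const_mul _).const_mul _)
  have hpa : pd j a y = pd j X.p y
      + 1 / sphereArea n * (1 / 2 * pd j (fun z => X.gradSq z / X.W z ^ 2) y) := by
    rw [ha, pd_add j hdp ((hdu.const_mul _).const_mul _),
      pd_mul j (differentiableAt_const _) (hdu.const_mul _),
      pd_mul j (differentiableAt_const _) hdu, pd_const, pd_const]
    ring
  have hgs : pd j X.gradSq y = 2 * ∑ i, gradient X.h X.φ i y * pd j (pd i X.φ) y
      - 2 * ∑ i, ∑ k, christoffel X.h i j k y * gradient X.h X.φ k y * pd i X.φ y :=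
    pd_gradient_sq hh hy hX.smooth_φ j
  have hpT : ∀ i, pd i (X.spatialStress i j) y = pd i a y * (1 : Matrix _ _ ℝ) i j
      - 1 / sphereArea n * (pd i (X.electric i) y * pd j X.φ y
        + X.electric i y * pd j (pd i X.φ) y) := by
    intro i
    rw [pd_congr i hΩ hy fun z _ => hT i j z,
      pd_sub i (hda.mul_const _) (((hdV i).fun_mul (hdφ j)).const_mul _),
      pd_mul i hda (differentiableAt_const _),
      pd_mul i (differentiableAt_const _) ((hdV i).fun_mul (hdφ j)), pd_mul i (hdV i) (hdφ j),
      pd_const, pd_const, pd_comm j i hΩ hy hX.smooth_φ]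
    ring
  have s1 : ∑ i, pd i (X.spatialStress i j) y = pd j a y - 1 / sphereArea n *
      ((∑ i, pd i (X.electric i) y) * pd j X.φ y
        + ∑ i, X.electric i y * pd j (pd i X.φ) y) := by
    simp only [hpT, Finset.sum_sub_distrib, ← Finset.mul_sum, Finset.sum_add_distrib,
      ← Finset.sum_mul, Matrix.one_apply, mul_ite, mul_one, mul_zero, Finset.sum_ite_eq',
      Finset.mem_univ, if_true]
  have s2 : ∑ i, (pd i X.W y / X.W y + ∑ k, christoffel X.h k k i y) * X.spatialStress i j y
      = (pd j X.W y / X.W y + ∑ k, christoffel X.h k k j y) * a y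
        - 1 / sphereArea n * ((∑ i, pd i X.W y / X.W y * X.electric i y
          + ∑ i, (∑ k, christoffel X.h k k i y) * X.electric i y) * pd j X.φ y) := by
    rw [← Finset.sum_add_distrib, Finset.sum_mul, Finset.mul_sum]
    have : (pd j X.W y / X.W y + ∑ k, christoffel X.h k k j y) * a y
        = ∑ i, (pd i X.W y / X.W y + ∑ k, christoffel X.h k k i y)
          * (a y * (1 : Matrix _ _ ℝ) i j) := by
      simp [Matrix.one_apply]
    rw [this, ← Finset.sum_sub_distrib]
    refine Finset.sum_congr rfl fun i _ => ?_
    rw [hT]; ring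
  have s3 : ∑ i, ∑ k, christoffel X.h i j k y * X.spatialStress k i y
      = (∑ k, christoffel X.h k k j y) * a y
        - 1 / sphereArea n * ∑ i, ∑ k, christoffel X.h i j k y * X.electric k y * pd i X.φ y := by
    simp only [hT, mul_sub, Finset.sum_sub_distrib]
    congr 1
    · rw [Finset.sum_mul]
      refine Finset.sum_congr rfl fun i _ => ?_
      simp [Matrix.one_apply, hh.christoffel_symm hy i j i]
    · simp only [Finset.mul_sum]
      exact Finset.sum_congr rfl fun i _ => Finset.sum_congr rfl fun k _ => by ring
  have s4 : ∑ i, X.electric i y * pd j (pd i X.φ) y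
      = (∑ i, gradient X.h X.φ i y * pd j (pd i X.φ) y) / X.W y ^ 2 := by
    rw [Finset.sum_div]
    exact Finset.sum_congr rfl fun i _ => by rw [electric]; ring
  have s5 : ∑ i, ∑ k, christoffel X.h i j k y * X.electric k y * pd i X.φ y
      = (∑ i, ∑ k, christoffel X.h i j k y * gradient X.h X.φ k y * pd i X.φ y)
        / X.W y ^ 2 := by
    simp only [Finset.sum_div]
    exact Finset.sum_congr rfl fun i _ => Finset.sum_congr rfl fun k _ => by
      rw [electric]; ring
  rw [divergence, Finset.sum_add_distrib] at hgl
  rw [s1, s2, s3, hpa, hu, hgs, s4, s5, energyDensity] at hB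
  have hay : a y = X.p y + 1 / sphereArea n * (1 / 2 * (X.gradSq y / X.W y ^ 2)) := rfl
  rw [hay] at hB
  generalize ∑ i, gradient X.h X.φ i y * pd j (pd i X.φ) y = A at hB
  generalize ∑ i, ∑ k, christoffel X.h i j k y * gradient X.h X.φ k y * pd i X.φ y = B at hB
  generalize ∑ i, pd i (X.electric i) y = C at hB hgl
  generalize ∑ i, (∑ k, christoffel X.h k k i y) * X.electric i y = D at hB hgl
  generalize ∑ i, pd i X.W y / X.W y * X.electric i y = E at hB hgl
  generalize ∑ k, christoffel X.h k k j y = F at hB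
  -- Gauss' law replaces the divergence of the electric field. All remaining Maxwell stress terms
  -- (`A`, `B`, `D`, `E`, `F`) cancel, and only the Lorentz force ρ_e ∂_j φ survives.
  have hC : C = -(sphereArea n * X.ρe y / X.W y) - D - E := by linarith
  rw [hC] at hB
  have hB' := congrArg (fun t => X.W y * t) hB
  simp only [mul_zero] at hB'
  rw [← hB']
  field_simp
  ring

end IsEinsteinMaxwell

end StaticFluid

end EMFluid

end

/-! ### Divergence theorem for compactly supported fields, and two auxiliary functions. -/

noncomputable section

namespace EMFluid

open MeasureTheory

section Integration

variable {ι : Type*} [Fintype ι] [DecidableEq ι] {h : (ι → ℝ) → Matrix ι ι ℝ} {Ω K : Set (ι → ℝ)}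
  {y : ι → ℝ}

/-- The volume density `√(det h)`. -/
def volumeDensity (h : (ι → ℝ) → Matrix ι ι ℝ) (y : ι → ℝ) : ℝ := √(h y).det

theorem contDiffOn_volumeDensity (hh : IsMetricOn h Ω) (hpos : ∀ z ∈ Ω, 0 < (h z).det) :
    ContDiffOn ℝ ∞ (volumeDensity h) Ω :=
  hh.smooth.det.sqrt fun z hz => (hpos z hz).ne'

/-- Jacobi's formula reduces the claim to the trace of h⁻¹ ∂_i h, which metric compatibility
evaluates as twice the trace of the connection matrix. It makes √(det h) div V an ordinary
coordinate divergence. -/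
theorem pd_volumeDensity (hh : IsMetricOn h Ω) (hpos : ∀ z ∈ Ω, 0 < (h z).det) (hy : y ∈ Ω)
    (i : ι) : pd i (volumeDensity h) y
      = volumeDensity h y * ∑ k, christoffel h k k i y := by
  have hd := hpos y hy
  have hdet := differentiableAt_of_contDiffOn hh.isOpen hy hh.smooth.det
  have h1 : pd i (volumeDensity h) y
      = 1 / (2 * √(h y).det) * pd i (fun z => (h z).det) y := by
    have := pd_comp (A := Real.sqrt) i (Real.hasDerivAt_sqrt hd.ne').differentiableAt hdet
    rwa [(Real.hasDerivAt_sqrt hd.ne').deriv] at this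
  have hadj : (h y).adjugate = (h y).det • (h y)⁻¹ := by
    rw [Matrix.inv_def, smul_smul, Ring.mul_inverse_cancel _ (hh.det y hy), one_smul]
  have htr : ((h y).adjugate * matPd i h y).trace
      = 2 * (h y).det * ∑ k, christoffel h k k i y := by
    rw [hadj, hh.matPd_metric hy, Matrix.smul_mul, Matrix.trace_smul, mul_add, ← mul_assoc,
      hh.inv_mul hy, one_mul, Matrix.trace_add, ← mul_assoc, Matrix.trace_mul_cycle,
      hh.mul_inv hy, one_mul, Matrix.trace_transpose, smul_eq_mul]
    have : (connection h i y).trace = ∑ k, christoffel h k k i y := by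
      simp only [Matrix.trace, Matrix.diag_apply, connection, Matrix.of_apply]
      exact Finset.sum_congr rfl fun k _ => hh.christoffel_symm hy k i k
    rw [this]; ring
  rw [h1, pd_det hh.isOpen hy hh.smooth, htr, volumeDensity]
  have hs : 0 < √(h y).det := Real.sqrt_pos.mpr hd
  field_simp
  rw [Real.sq_sqrt hd.le]

/-- Integration by parts against the constant function 1. -/
theorem integral_pd_eq_zero {U : (ι → ℝ) → ℝ} (hU : ContDiff ℝ 1 U) (hc : HasCompactSupport U)
    (i : ι) : Integrable (pd i U) ∧ ∫ y, pd i U y = 0 := by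
  have hcont : Continuous (pd i U) := (hU.continuous_fderiv one_ne_zero).clm_apply continuous_const
  have hsupp : HasCompactSupport (pd i U) := hc.fderiv_apply ℝ _
  have hint : Integrable (pd i U) := hcont.integrable_of_hasCompactSupport hsupp
  refine ⟨hint, ?_⟩
  have := integral_mul_fderiv_eq_neg_fderiv_mul_of_integrable (μ := (volume : Measure (ι → ℝ)))
    (f := fun _ => (1 : ℝ)) (g := U) (v := Pi.single i 1) (by simp)
    (by simp only [one_mul]; exact hint)
    (by simpa using hU.continuous.integrable_of_hasCompactSupport hc)
    (fun x _ => differentiableAt_const _) (fun x _ => hU.differentiable one_ne_zero x)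
  simpa [pd] using this

/-- The divergence theorem for a vector field with compact support in `Ω`. -/
theorem integral_divergence_eq_zero (hh : IsMetricOn h Ω) (hpos : ∀ z ∈ Ω, 0 < (h z).det)
    (hK : IsCompact K) (hKΩ : K ⊆ Ω) {V : ι → (ι → ℝ) → ℝ}
    (hV : ∀ i, ContDiffOn ℝ 1 (V i) Ω) (hV0 : ∀ i, ∀ z ∈ Ω, z ∉ K → V i z = 0) :
    IntegrableOn (fun z => volumeDensity h z * divergence h V z) Ω ∧
      ∫ z in Ω, volumeDensity h z * divergence h V z = 0 := by
  have hΩ := hh.isOpen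
  -- Extension by zero: it is C¹ on the whole space, because Ω and the complement of K form an open
  -- cover and the extension vanishes on the latter.
  set U : ι → (ι → ℝ) → ℝ := fun i => Ω.indicator fun z => volumeDensity h z * V i z with hUdef
  have hU0 : ∀ i, ∀ z ∉ K, U i z = 0 := by
    intro i z hz
    by_cases hzΩ : z ∈ Ω
    · simp [hUdef, hzΩ, hV0 i z hzΩ hz]
    · simp [hUdef, hzΩ]
  have hvol : ContDiffOn ℝ 1 (volumeDensity h) Ω :=
    (contDiffOn_volumeDensity hh hpos).of_le (by exact_mod_cast le_top)
  have hU : ∀ i, ContDiff ℝ 1 (U i) := by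
    intro i
    rw [contDiff_iff_contDiffAt]
    intro z
    by_cases hz : z ∈ K
    · have hzΩ := hΩ.mem_nhds (hKΩ hz)
      refine ((hvol.mul (hV i)).contDiffAt hzΩ).congr_of_eventuallyEq ?_
      filter_upwards [hzΩ] with w hw
      simp [hUdef, hw]
    · refine (contDiffAt_const (c := (0 : ℝ))).congr_of_eventuallyEq ?_
      filter_upwards [hK.isClosed.isOpen_compl.mem_nhds hz] with w hw using hU0 i w hw
  have hUc : ∀ i, HasCompactSupport (U i) := fun i => HasCompactSupport.intro hK (hU0 i)
  have hpd : ∀ i, ∀ z ∈ Ω, pd i (U i) z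
      = volumeDensity h z * (pd i (V i) z + (∑ k, christoffel h k k i z) * V i z) := by
    intro i z hz
    have h1 : pd i (U i) z = pd i (fun w => volumeDensity h w * V i w) z :=
      pd_congr i hΩ hz fun w hw => by simp [hUdef, hw]
    rw [h1, pd_mul i ((hvol.contDiffAt (hΩ.mem_nhds hz)).differentiableAt one_ne_zero)
      (((hV i).contDiffAt (hΩ.mem_nhds hz)).differentiableAt one_ne_zero),
      pd_volumeDensity hh hpos hz]
    ring
  have hpd0 : ∀ i, ∀ z ∉ Ω, pd i (U i) z = 0 := by
    intro i z hz
    have := pd_congr (f := U i) (g := fun _ => 0) i hK.isClosed.isOpen_compl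
      (fun hzK => hz (hKΩ hzK)) (hU0 i)
    rw [this, pd_const]
  have hsum : ∀ z ∈ Ω, volumeDensity h z * divergence h V z = ∑ i, pd i (U i) z := by
    intro z hz
    rw [divergence, Finset.mul_sum]
    exact Finset.sum_congr rfl fun i _ => (hpd i z hz).symm
  have hint : Integrable fun z => ∑ i, pd i (U i) z :=
    integrable_finsetSum _ fun i _ => (integral_pd_eq_zero (hU i) (hUc i) i).1
  refine ⟨hint.integrableOn.congr_fun (fun z hz => (hsum z hz).symm) hΩ.measurableSet, ?_⟩
  rw [setIntegral_congr_fun hΩ.measurableSet hsum,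
    setIntegral_eq_integral_of_forall_compl_eq_zero fun z hz =>
      Finset.sum_eq_zero fun i _ => hpd0 i z hz,
    integral_finsetSum _ fun i _ => (integral_pd_eq_zero (hU i) (hUc i) i).1]
  exact Finset.sum_eq_zero fun i _ => (integral_pd_eq_zero (hU i) (hUc i) i).2

/-- A `C¹` regularization of `√|q|` which nearly solves `2 q r' = r`. -/
theorem exists_regularized_sqrt {t : ℝ} (ht : 0 < t) :
    ∃ r : ℝ → ℝ, ContDiff ℝ 1 r ∧ (∀ q, √|q| ≤ r q) ∧ ∀ q, |2 * q * deriv r q - r q| ≤ t := by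
  have hR : ∀ q : ℝ, 0 < q ^ 2 + t ^ 4 := fun q => by positivity
  -- With r = (q² + t⁴)^(1/4) the error 2 q r' - r equals -t⁴ (q² + t⁴)^(-3/4). It is largest in
  -- size at q = 0, where it is t; this is why the shift is t⁴.
  refine ⟨fun q => (q ^ 2 + t ^ 4) ^ (1 / 4 : ℝ), ?_, fun q => ?_, fun q => ?_⟩
  · exact ContDiff.rpow_const_of_ne (by fun_prop) fun q => (hR q).ne'
  · have h1 : √|q| = (q ^ 2) ^ (1 / 4 : ℝ) := by
      rw [← sq_abs, ← Real.rpow_natCast, ← Real.rpow_mul (abs_nonneg q), Real.sqrt_eq_rpow]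
      norm_num
    rw [h1]
    exact Real.rpow_le_rpow (by positivity) (by nlinarith [pow_pos ht 4]) (by norm_num)
  · have hd : HasDerivAt (fun q : ℝ => (q ^ 2 + t ^ 4) ^ (1 / 4 : ℝ))
        (2 * q * (1 / 4) * (q ^ 2 + t ^ 4) ^ (1 / 4 - 1 : ℝ)) q := by
      have h0 : HasDerivAt (fun q : ℝ => q ^ 2 + t ^ 4) (2 * q) q := by
        simpa using (hasDerivAt_pow 2 q).add_const (t ^ 4)
      exact h0.rpow_const (Or.inl (hR q).ne')
    rw [hd.deriv]
    have h1 : (q ^ 2 + t ^ 4) ^ (1 / 4 : ℝ)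
        = (q ^ 2 + t ^ 4) * (q ^ 2 + t ^ 4) ^ (1 / 4 - 1 : ℝ) := by
      rw [Real.rpow_sub_one (hR q).ne']
      have := (hR q).ne'
      field_simp
    simp only [h1]
    have h2 : 2 * q * (2 * q * (1 / 4) * (q ^ 2 + t ^ 4) ^ (1 / 4 - 1 : ℝ))
        - (q ^ 2 + t ^ 4) * (q ^ 2 + t ^ 4) ^ (1 / 4 - 1 : ℝ)
        = -(t ^ 4 * (q ^ 2 + t ^ 4) ^ (1 / 4 - 1 : ℝ)) := by ring
    have h3 : (q ^ 2 + t ^ 4) ^ (1 / 4 - 1 : ℝ) ≤ (t ^ 4) ^ (1 / 4 - 1 : ℝ) :=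
      Real.rpow_le_rpow_of_nonpos (by positivity) (by nlinarith [sq_nonneg q]) (by norm_num)
    have h4 : t ^ 4 * (t ^ 4) ^ (1 / 4 - 1 : ℝ) = t := by
      have h5 : (t ^ 4) ^ (1 / 4 : ℝ) = t := by
        rw [← Real.rpow_natCast, ← Real.rpow_mul ht.le]; norm_num
      have h6 : t ^ 4 ≠ 0 := by positivity
      rw [Real.rpow_sub_one h6, h5]
      field_simp
    rw [h2, abs_neg, abs_of_nonneg (by have := (hR q).le; positivity)]
    calc _ ≤ t ^ 4 * (t ^ 4) ^ (1 / 4 - 1 : ℝ) := by gcongr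
      _ = t := h4

/-- A `C¹` function vanishing near `c` and increasing elsewhere. -/
theorem exists_increasing_off (c η : ℝ) :
    ∃ g : ℝ → ℝ, ContDiff ℝ 1 g ∧ (∀ v, |v - c| ≤ η → g v = 0) ∧
      ∀ v, deriv g v = max (|v - c| - η) 0 := by
  have hk : Continuous fun v : ℝ => max (|v - c| - η) 0 := by fun_prop
  have hd : ∀ v, HasDerivAt (fun v => ∫ u in c..v, max (|u - c| - η) 0) (max (|v - c| - η) 0) v :=
    fun v => hk.deriv_integral _ c v ▸
      (intervalIntegral.differentiable_integral_of_continuous hk v).hasDerivAt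
  refine ⟨fun v => ∫ u in c..v, max (|u - c| - η) 0, ?_, fun v hv => ?_, fun v => (hd v).deriv⟩
  · rw [contDiff_one_iff_deriv]
    exact ⟨fun v => (hd v).differentiableAt, by
      rw [show deriv _ = _ from funext fun v => (hd v).deriv]
      exact hk⟩
  · have : ∀ u ∈ Set.uIcc c v, max (|u - c| - η) 0 = (0 : ℝ) := fun u hu => by
      have := Set.abs_sub_left_of_mem_uIcc hu
      exact max_eq_right (by linarith)
    simp only [intervalIntegral.integral_congr this, intervalIntegral.integral_zero]

end Integration

end EMFluid

end

/-! ### The vanishing argument: formally divergence-free multiples of ∇φ/W are zero. -/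

noncomputable section

namespace EMFluid

open MeasureTheory

theorem uniqueDiffOn_of_ordConnected {J : Set ℝ} (hJ : J.OrdConnected) (hJn : J.Nontrivial) :
    UniqueDiffOn ℝ J := by
  obtain ⟨u, hu, v, hv, huv⟩ := hJn.exists_lt
  refine uniqueDiffOn_convex hJ.convex ⟨(u + v) / 2, ?_⟩
  rw [mem_interior]
  exact ⟨Set.Ioo u v, Set.Ioo_subset_Icc_self.trans (hJ.out hu hv), isOpen_Ioo,
    by linarith, by linarith⟩

/-- A nondegenerate interval determines derivatives at all its points, endpoints included. This is
needed because φ(Ω) need not be open and identities are known on it only. -/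
theorem hasDerivAt_unique_of_eqOn {J : Set ℝ} (hJ : J.OrdConnected) (hJn : J.Nontrivial)
    {f g : ℝ → ℝ} {a b v : ℝ} (hv : v ∈ J) (hfg : Set.EqOn f g J) (hf : HasDerivAt f a v)
    (hg : HasDerivAt g b v) : a = b :=
  (uniqueDiffOn_of_ordConnected hJ hJn v hv).eq_deriv J hf.hasDerivWithinAt
    (hg.hasDerivWithinAt.congr hfg (hfg hv))

namespace StaticFluid

variable {n : ℕ} {X : StaticFluid n} {G : ℝ} {Ω : Set (Fin n → ℝ)} {y : Fin n → ℝ}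

theorem gradSq_eq (y : Fin n → ℝ) : X.gradSq y
    = (fun i => pd i X.φ y) ⬝ᵥ ((X.h y)⁻¹ *ᵥ fun i => pd i X.φ y) := by
  rw [gradSq, dotProduct]
  exact Finset.sum_congr rfl fun i _ => mul_comm _ _

namespace IsEinsteinMaxwell

theorem gradSq_pos (hX : X.IsEinsteinMaxwell G Ω) (hy : y ∈ Ω)
    (h : (fun i => pd i X.φ y) ≠ 0) : 0 < X.gradSq y := by
  have := (hX.h_posDef y hy).inv.dotProduct_mulVec_pos h
  rwa [gradSq_eq]

theorem gradSq_nonneg (hX : X.IsEinsteinMaxwell G Ω) (hy : y ∈ Ω) : 0 ≤ X.gradSq y := by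
  by_cases h : (fun i => pd i X.φ y) = 0
  · rw [gradSq_eq, h]; simp
  · exact (hX.gradSq_pos hy h).le

theorem ρem_nonneg (hn : 3 ≤ n) (hX : X.IsEinsteinMaxwell G Ω) (hy : y ∈ Ω) :
    0 ≤ X.ρem y := by
  have := hX.gradSq_nonneg hy
  have := sphereArea_pos (n := n) (by omega)
  rw [ρem_eq]; positivity

theorem ρem_eq_zero_iff (hn : 3 ≤ n) (hX : X.IsEinsteinMaxwell G Ω) (hy : y ∈ Ω) :
    X.ρem y = 0 ↔ ∀ i, pd i X.φ y = 0 := by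
  have hS := (sphereArea_pos (n := n) (by omega)).ne'
  have hW := (hX.W_pos y hy).ne'
  constructor
  · intro h i
    by_contra hi
    have := (hX.gradSq_pos hy fun h0 => hi (congrFun h0 i)).ne'
    rw [ρem_eq] at h
    simp [hS, hW, this] at h
  · intro h
    rw [ρem_eq, gradSq]
    simp [h]

theorem contDiffOn_ρem (hX : X.IsEinsteinMaxwell G Ω) (hΩ : IsOpen Ω) :
    ContDiffOn ℝ ∞ X.ρem Ω := by
  have h2 : ∀ z ∈ Ω, X.W z ^ 2 ≠ 0 := fun z hz => pow_ne_zero 2 (hX.W_pos z hz).ne'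
  exact (contDiffOn_const.mul ((hX.contDiffOn_gradSq hΩ).div (hX.smooth_W.pow 2) h2)).congr
    fun z _ => ρem_eq z

theorem det_pos (hX : X.IsEinsteinMaxwell G Ω) : ∀ z ∈ Ω, 0 < (X.h z).det :=
  fun z hz => (hX.h_posDef z hz).det_pos

/-- The divergence of `A(φ) ∇^i φ / W`. -/
theorem divergence_comp (hn : 3 ≤ n) (hX : X.IsEinsteinMaxwell G Ω) (hΩ : IsOpen Ω) (hy : y ∈ Ω)
    {A : ℝ → ℝ} (hA : DifferentiableAt ℝ A (X.φ y)) :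
    divergence X.h (fun i z => A (X.φ z) * (gradient X.h X.φ i z / X.W z)) y
      = sphereArea n * (deriv A (X.φ y) * X.W y * X.ρem y - A (X.φ y) * X.ρe y) := by
  have hW := (hX.W_pos y hy).ne'
  have hS := (sphereArea_pos (n := n) (by omega)).ne'
  have hφ := hX.diff_φ hΩ hy
  have hV : ∀ i, DifferentiableAt ℝ (fun z => gradient X.h X.φ i z / X.W z) y := fun i =>
    differentiableAt_of_contDiffOn hΩ hy ((contDiffOn_gradient (hX.spatial hΩ) hX.smooth_φ i).div
      hX.smooth_W fun z hz => (hX.W_pos z hz).ne')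
  rw [divergence_mul (f := fun z => A (X.φ z)) (hA.comp y hφ) hV,
    hX.divergence_gradient_φ hΩ hy]
  have h1 : ∑ i, pd i (fun z => A (X.φ z)) y * (gradient X.h X.φ i y / X.W y)
      = deriv A (X.φ y) * (X.gradSq y / X.W y) := by
    rw [gradSq, Finset.sum_div, Finset.mul_sum]
    refine Finset.sum_congr rfl fun i _ => ?_
    rw [pd_comp i hA hφ]; ring
  rw [h1, ρem_eq]
  field_simp
  ring

end IsEinsteinMaxwell

/-- The part of `Ω` on which the potential stays away from its boundary value. -/
theorem isCompact_potential_off {φ : (Fin n → ℝ) → ℝ} (hΩ : IsOpen Ω)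
    (hbdd : Bornology.IsBounded Ω) (hφ : ContinuousOn φ (closure Ω)) {φ₀ : ℝ}
    (hbdry : ∀ y ∈ frontier Ω, φ y = φ₀) {η : ℝ} (hη : 0 < η) :
    IsCompact (closure Ω ∩ {z | η ≤ |φ z - φ₀|}) ∧
      closure Ω ∩ {z | η ≤ |φ z - φ₀|} ⊆ Ω := by
  refine ⟨Metric.isCompact_of_isClosed_isBounded ?_ (hbdd.closure.subset Set.inter_subset_left),
    fun z hz => ?_⟩
  · exact (hφ.sub continuousOn_const).abs.preimage_isClosed_of_isClosed isClosed_closure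
      (isClosed_Ici (a := η))
  · by_contra hzΩ
    have hzf : z ∈ frontier Ω := by
      rw [frontier, hΩ.interior_eq]; exact ⟨hz.1, hzΩ⟩
    have := hz.2
    rw [Set.mem_ofPred_eq, hbdry z hzf, sub_self, abs_zero] at this
    linarith

variable {φ₀ η : ℝ} {A : ℝ → ℝ}

/-- The weak form of Gauss' law for test functions of the potential. -/
theorem IsEinsteinMaxwell.integral_test (hn : 3 ≤ n) (hX : X.IsEinsteinMaxwell G Ω)
    (hΩ : IsOpen Ω) (hbdd : Bornology.IsBounded Ω) (hφ : ContinuousOn X.φ (closure Ω))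
    (hbdry : ∀ y ∈ frontier Ω, X.φ y = φ₀) (hη : 0 < η) (hA : ContDiff ℝ 1 A)
    (hA0 : ∀ v, |v - φ₀| ≤ η → A v = 0) :
    IntegrableOn (fun z => volumeDensity X.h z *
        (deriv A (X.φ z) * X.W z * X.ρem z - A (X.φ z) * X.ρe z)) Ω ∧
      ∫ z in Ω, volumeDensity X.h z *
        (deriv A (X.φ z) * X.W z * X.ρem z - A (X.φ z) * X.ρe z) = 0 := by
  obtain ⟨hK, hKΩ⟩ := isCompact_potential_off hΩ hbdd hφ hbdry hη
  have hS := (sphereArea_pos (n := n) (by omega)).ne'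
  have h1 : (1 : WithTop ℕ∞) ≤ ∞ := by exact_mod_cast le_top
  have hV : ∀ i, ContDiffOn ℝ 1
      (fun z => A (X.φ z) * (gradient X.h X.φ i z / X.W z)) Ω := fun i =>
    (hA.comp_contDiffOn (hX.smooth_φ.of_le h1)).mul
      (((contDiffOn_gradient (hX.spatial hΩ) hX.smooth_φ i).div hX.smooth_W
        fun z hz => (hX.W_pos z hz).ne').of_le h1)
  obtain ⟨hi, h0⟩ := integral_divergence_eq_zero (hX.spatial hΩ) hX.det_pos hK hKΩ hV
    fun i z hz hzK => by
      have : |X.φ z - φ₀| ≤ η := by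
        by_contra hcon
        exact hzK ⟨subset_closure hz, (not_le.mp hcon).le⟩
      simp [hA0 _ this]
  have hdiv : ∀ z ∈ Ω, volumeDensity X.h z *
      divergence X.h (fun i z => A (X.φ z) * (gradient X.h X.φ i z / X.W z)) z
      = sphereArea n * (volumeDensity X.h z *
        (deriv A (X.φ z) * X.W z * X.ρem z - A (X.φ z) * X.ρe z)) := fun z hz => by
    rw [hX.divergence_comp hn hΩ hz (hA.differentiable one_ne_zero _)]; ring
  have hi' := hi.congr_fun hdiv hΩ.measurableSet
  rw [setIntegral_congr_fun hΩ.measurableSet hdiv, integral_const_mul] at h0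
  refine ⟨?_, (mul_eq_zero.mp h0).resolve_left hS⟩
  have := hi'.const_mul (sphereArea n)⁻¹
  rw [IntegrableOn]
  simpa [← mul_assoc, hS] using this

/-- The integral is zero, so f vanishes almost everywhere; continuity on an open set removes the
exceptional null set. -/
theorem eqOn_zero_of_setIntegral_nonpos {f : (Fin n → ℝ) → ℝ} (hΩ : IsOpen Ω)
    (hf : ContinuousOn f Ω) (hfi : IntegrableOn f Ω) (hf0 : ∀ z ∈ Ω, 0 ≤ f z)
    (hint : ∫ z in Ω, f z ≤ 0) : ∀ z ∈ Ω, f z = 0 := by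
  have hnn : 0 ≤ᵐ[volume.restrict Ω] f := by
    filter_upwards [ae_restrict_mem hΩ.measurableSet] with z hz using hf0 z hz
  have h0 : f =ᵐ[volume.restrict Ω] 0 :=
    (integral_eq_zero_iff_of_nonneg_ae hnn hfi).mp
      (le_antisymm hint (integral_nonneg_of_ae hnn))
  exact Measure.eqOn_open_of_ae_eq h0 hΩ hf continuousOn_const

/-- A function `Q` of the potential for which `√|Q| ∇φ / W` is formally divergence-free vanishes
wherever the potential differs from its boundary value and is not critical. -/
theorem IsEinsteinMaxwell.mul_ρem_eq_zero_of_ne (hn : 3 ≤ n) (hX : X.IsEinsteinMaxwell G Ω)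
    (hΩ : IsOpen Ω) (hbdd : Bornology.IsBounded Ω) (hφ : ContinuousOn X.φ (closure Ω))
    (hbdry : ∀ y ∈ frontier Ω, X.φ y = φ₀) {Q : ℝ → ℝ} (hQ : ContDiff ℝ 1 Q)
    (hQe : ∀ z ∈ Ω, X.W z * deriv Q (X.φ z) * X.ρem z = 2 * Q (X.φ z) * X.ρe z)
    (hy : y ∈ Ω) (hne : X.φ y ≠ φ₀) : Q (X.φ y) * X.ρem y = 0 := by
  -- Half the distance to the boundary value, so that the cutoff g has g'(φ(y)) = η > 0 at the given
  -- point.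
  set η := |X.φ y - φ₀| / 2 with hηdef
  have habs : 0 < |X.φ y - φ₀| := abs_pos.mpr (sub_ne_zero.mpr hne)
  have hη : 0 < η := half_pos habs
  obtain ⟨hK, hKΩ⟩ := isCompact_potential_off hΩ hbdd hφ hbdry hη
  obtain ⟨g, hg, hg0, hg'⟩ := exists_increasing_off φ₀ η
  have hφΩ : ContinuousOn X.φ Ω := hφ.mono subset_closure
  have hvol : ContinuousOn (volumeDensity X.h) Ω :=
    (contDiffOn_volumeDensity (hX.spatial hΩ) hX.det_pos).continuousOn
  have hgφ : ContinuousOn (fun z => g (X.φ z)) Ω := hg.continuous.comp_continuousOn hφΩ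
  have hQφ : ContinuousOn (fun z => Q (X.φ z)) Ω := hQ.continuous.comp_continuousOn hφΩ
  have hg'φ : ContinuousOn (fun z => deriv g (X.φ z)) Ω :=
    (hg.continuous_deriv le_rfl).comp_continuousOn hφΩ
  have hout : ∀ z ∈ Ω \ (closure Ω ∩ {z | η ≤ |X.φ z - φ₀|}), |X.φ z - φ₀| ≤ η := by
    intro z hz
    by_contra hcon
    exact hz.2 ⟨subset_closure hz.1, (not_le.mp hcon).le⟩
  -- `f₀` is the limiting nonnegative integrand, and `t * f₁` bounds the error of the
  -- regularization. Both vanish outside the compact set where |φ - φ₀| ≥ η, which gives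
  -- integrability on Ω.
  set f₀ : (Fin n → ℝ) → ℝ := fun z => volumeDensity X.h z *
    (deriv g (X.φ z) * √|Q (X.φ z)| * X.W z * X.ρem z) with hf₀
  set f₁ : (Fin n → ℝ) → ℝ := fun z => volumeDensity X.h z * |g (X.φ z) * X.ρe z| with hf₁
  have hc₀ : ContinuousOn f₀ Ω := hvol.mul (((hg'φ.mul (hQφ.abs.sqrt)).mul
    hX.smooth_W.continuousOn).mul (hX.contDiffOn_ρem hΩ).continuousOn)
  have hc₁ : ContinuousOn f₁ Ω := hvol.mul (hgφ.mul hX.smooth_ρe.continuousOn).abs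
  have hi₀ : IntegrableOn f₀ Ω := by
    refine ((hc₀.mono hKΩ).integrableOn_compact hK).of_forall_sdiff_eq_zero hΩ.measurableSet
      fun z hz => ?_
    have : deriv g (X.φ z) = 0 := by
      rw [hg']; exact max_eq_right (by linarith [hout z hz])
    simp [hf₀, this]
  have hi₁ : IntegrableOn f₁ Ω := by
    refine ((hc₁.mono hKΩ).integrableOn_compact hK).of_forall_sdiff_eq_zero hΩ.measurableSet
      fun z hz => ?_
    simp [hf₁, hg0 _ (hout z hz)]
  have hg'nn : ∀ v, 0 ≤ deriv g v := fun v => by rw [hg']; exact le_max_right _ _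
  have hbound : ∀ t > 0, ∫ z in Ω, f₀ z ≤ t * ∫ z in Ω, f₁ z := by
    intro t ht
    obtain ⟨r, hr, hr1, hr2⟩ := exists_regularized_sqrt ht
    have hA : ContDiff ℝ 1 fun v => g v * r (Q v) := hg.mul (hr.comp hQ)
    obtain ⟨hi, h0⟩ := hX.integral_test hn hΩ hbdd hφ hbdry hη hA
      fun v hv => by simp [hg0 v hv]
    have hle : ∀ z ∈ Ω, f₀ z - t * f₁ z ≤ volumeDensity X.h z *
        (deriv (fun v => g v * r (Q v)) (X.φ z) * X.W z * X.ρem z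
          - g (X.φ z) * r (Q (X.φ z)) * X.ρe z) := by
      intro z hz
      have hd : deriv (fun v => g v * r (Q v)) (X.φ z) = deriv g (X.φ z) * r (Q (X.φ z))
          + g (X.φ z) * (deriv r (Q (X.φ z)) * deriv Q (X.φ z)) :=
        (((hg.differentiable one_ne_zero _).hasDerivAt).mul
          (((hr.differentiable one_ne_zero _).hasDerivAt).comp (X.φ z)
            (hQ.differentiable one_ne_zero _).hasDerivAt)).deriv
      have hW := (hX.W_pos z hz).le
      have hρ := hX.ρem_nonneg hn hz
      -- The equation for Q replaces r' Q' W ρ_em by 2 Q r' ρ_e, so that the regularization error 2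
      -- Q r' - r appears as a factor.
      have h1 : (deriv (fun v => g v * r (Q v)) (X.φ z) * X.W z * X.ρem z
          - g (X.φ z) * r (Q (X.φ z)) * X.ρe z)
          = deriv g (X.φ z) * r (Q (X.φ z)) * X.W z * X.ρem z
            + g (X.φ z) * X.ρe z *
              (2 * Q (X.φ z) * deriv r (Q (X.φ z)) - r (Q (X.φ z))) := by
        rw [hd]
        linear_combination g (X.φ z) * deriv r (Q (X.φ z)) * hQe z hz
      have h2 : deriv g (X.φ z) * √|Q (X.φ z)| * X.W z * X.ρem z
          ≤ deriv g (X.φ z) * r (Q (X.φ z)) * X.W z * X.ρem z := by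
        have := hr1 (Q (X.φ z))
        have := hg'nn (X.φ z)
        gcongr
      have h3 : -(t * |g (X.φ z) * X.ρe z|) ≤ g (X.φ z) * X.ρe z *
          (2 * Q (X.φ z) * deriv r (Q (X.φ z)) - r (Q (X.φ z))) := by
        refine neg_le_of_abs_le ?_
        rw [abs_mul, mul_comm t]
        exact mul_le_mul_of_nonneg_left (hr2 _) (abs_nonneg _)
      rw [h1]
      have h4 : 0 ≤ volumeDensity X.h z := Real.sqrt_nonneg _
      calc f₀ z - t * f₁ z = volumeDensity X.h z *
            (deriv g (X.φ z) * √|Q (X.φ z)| * X.W z * X.ρem z - t * |g (X.φ z) * X.ρe z|) := by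
              simp only [hf₀, hf₁]; ring
        _ ≤ _ := mul_le_mul_of_nonneg_left (by linarith) h4
    have hmono := setIntegral_mono_on (hi₀.sub (hi₁.const_mul t)) hi hΩ.measurableSet hle
    rw [h0] at hmono
    have hsub : ∫ z in Ω, (f₀ - fun z => t * f₁ z) z
        = (∫ z in Ω, f₀ z) - t * ∫ z in Ω, f₁ z := by
      rw [integral_sub' hi₀ (hi₁.const_mul t), integral_const_mul]
    linarith [hsub ▸ hmono]
  have hle0 : ∫ z in Ω, f₀ z ≤ 0 := by
    have hlim : Filter.Tendsto (fun t : ℝ => t * ∫ z in Ω, f₁ z) (nhdsWithin 0 (Set.Ioi 0))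
        (nhds 0) := by
      have : Filter.Tendsto (fun t : ℝ => t * ∫ z in Ω, f₁ z) (nhds 0)
          (nhds (0 * ∫ z in Ω, f₁ z)) := (continuous_id.mul continuous_const).tendsto 0
      rw [zero_mul] at this
      exact this.mono_left nhdsWithin_le_nhds
    exact ge_of_tendsto hlim (by filter_upwards [self_mem_nhdsWithin] with t ht using hbound t ht)
  have hzero := eqOn_zero_of_setIntegral_nonpos hΩ hc₀ hi₀ (fun z hz => by
    have := (hX.W_pos z hz).le
    have := hX.ρem_nonneg hn hz
    have := hg'nn (X.φ z)
    have : 0 ≤ volumeDensity X.h z := Real.sqrt_nonneg _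
    simp only [hf₀]; positivity) hle0 y hy
  have hvpos : volumeDensity X.h y ≠ 0 := (Real.sqrt_pos.mpr (hX.det_pos y hy)).ne'
  have hgpos : deriv g (X.φ y) ≠ 0 := by
    rw [hg']; exact (lt_max_of_lt_left (by linarith)).ne'
  have hW := (hX.W_pos y hy).ne'
  simp only [hf₀, mul_eq_zero, hvpos, hgpos, hW, false_or, or_false] at hzero
  rcases hzero with h | h
  · rw [Real.sqrt_eq_zero (abs_nonneg _), abs_eq_zero] at h
    rw [h, zero_mul]
  · rw [h, mul_zero]

/-- This covers the points with φ = φ₀ too: if the product were nonzero at a point, it would be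
nonzero nearby, so φ would equal φ₀ on a neighbourhood and its gradient would vanish there. -/
theorem IsEinsteinMaxwell.mul_pd_eq_zero (hn : 3 ≤ n) (hX : X.IsEinsteinMaxwell G Ω)
    (hΩ : IsOpen Ω) (hbdd : Bornology.IsBounded Ω) (hφ : ContinuousOn X.φ (closure Ω))
    (hbdry : ∀ y ∈ frontier Ω, X.φ y = φ₀) {Q : ℝ → ℝ} (hQ : ContDiff ℝ 1 Q)
    (hQe : ∀ z ∈ Ω, X.W z * deriv Q (X.φ z) * X.ρem z = 2 * Q (X.φ z) * X.ρe z)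
    (hy : y ∈ Ω) (i : Fin n) : Q (X.φ y) * pd i X.φ y = 0 := by
  have hne : ∀ z ∈ Ω, X.φ z ≠ φ₀ → Q (X.φ z) * pd i X.φ z = 0 := by
    intro z hz hzφ
    rcases mul_eq_zero.mp (hX.mul_ρem_eq_zero_of_ne hn hΩ hbdd hφ hbdry hQ hQe hz hzφ) with h | h
    · rw [h, zero_mul]
    · rw [(hX.ρem_eq_zero_iff hn hz).mp h i, mul_zero]
  by_contra hcon
  have hcont : ContinuousOn (fun z => Q (X.φ z) * pd i X.φ z) Ω :=
    (hQ.continuous.comp_continuousOn (hφ.mono subset_closure)).mul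
      (contDiffOn_pd i hΩ hX.smooth_φ).continuousOn
  have hev : ∀ᶠ z in nhds y, Q (X.φ z) * pd i X.φ z ≠ 0 :=
    (hcont.continuousAt (hΩ.mem_nhds hy)).eventually_ne hcon
  have hconst : X.φ =ᶠ[nhds y] fun _ => φ₀ := by
    filter_upwards [hev, hΩ.mem_nhds hy] with z hz hzΩ
    by_contra hzφ
    exact hz (hne z hzΩ hzφ)
  apply hcon
  rw [pd, hconst.fderiv_eq]
  simp

/-- A function `Q` of the potential for which `√|Q| ∇φ / W` is formally divergence-free vanishes
on the range of the potential. -/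
theorem IsEinsteinMaxwell.eq_zero_of_divergence_free (hn : 3 ≤ n) (hX : X.IsEinsteinMaxwell G Ω)
    (hΩ : IsOpen Ω) (hconn : IsConnected Ω) (hbdd : Bornology.IsBounded Ω)
    (hφ : ContinuousOn X.φ (closure Ω)) (hbdry : ∀ y ∈ frontier Ω, X.φ y = φ₀)
    (hnt : (X.φ '' Ω).Nontrivial) {Q : ℝ → ℝ} (hQ : ContDiff ℝ 1 Q)
    (hQe : ∀ z ∈ Ω, X.W z * deriv Q (X.φ z) * X.ρem z = 2 * Q (X.φ z) * X.ρe z) :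
    ∀ v ∈ X.φ '' Ω, Q v = 0 := by
  have hH : ∀ v, HasDerivAt (fun v => ∫ u in (0 : ℝ)..v, Q u) (Q v) v := fun v =>
    hQ.continuous.deriv_integral _ 0 v ▸
      (intervalIntegral.differentiable_integral_of_continuous hQ.continuous v).hasDerivAt
  -- The gradient of H(φ) is Q(φ) ∇φ = 0, so H(φ) is constant on the connected set Ω.
  set H : ℝ → ℝ := fun v => ∫ u in (0 : ℝ)..v, Q u
  have hφd : ∀ z ∈ Ω, DifferentiableAt ℝ X.φ z := fun z hz => hX.diff_φ hΩ hz
  have hd0 : ∀ z ∈ Ω, fderiv ℝ (fun z => H (X.φ z)) z = 0 := by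
    intro z hz
    ext v
    have hz0 : ∀ i, fderiv ℝ (fun z => H (X.φ z)) z (Pi.single i 1) = 0 := fun i => by
      have := pd_comp i (hH (X.φ z)).differentiableAt (hφd z hz)
      rw [(hH _).deriv, hX.mul_pd_eq_zero hn hΩ hbdd hφ hbdry hQ hQe hz i] at this
      exact this
    rw [← LinearMap.sum_single_apply (fun _ => ℝ) v, map_sum]
    refine Finset.sum_eq_zero fun i _ => ?_
    have : (Pi.single i (v i) : Fin n → ℝ) = v i • Pi.single i (1 : ℝ) := by
      ext j
      by_cases hj : j = i
      · subst hj; simp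
      · simp [hj]
    change fderiv ℝ (fun z => H (X.φ z)) z (Pi.single i (v i)) = 0
    rw [this, map_smul, hz0, smul_zero]
  obtain ⟨a, ha⟩ := hΩ.exists_is_const_of_fderiv_eq_zero hconn.isPreconnected
    (fun z hz => ((hH _).differentiableAt.comp z (hφd z hz)).differentiableWithinAt)
    (f := fun z => H (X.φ z)) hd0
  have hJ : (X.φ '' Ω).OrdConnected :=
    (hconn.isPreconnected.image _ (hφ.mono subset_closure)).ordConnected
  intro v hv
  -- H is constant on the nondegenerate interval φ(Ω), so its derivative Q vanishes there.
  refine hasDerivAt_unique_of_eqOn hJ hnt hv (f := H) (g := fun _ => a) ?_ (hH v)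
    (hasDerivAt_const v a)
  rintro _ ⟨z, hz, rfl⟩
  exact ha z hz

end StaticFluid

end EMFluid

end

/-! ### Fluids of Weyl type: first integral, Weyl relation and constraint. -/

noncomputable section

namespace EMFluid

theorem eq_of_hasDerivAt_zero {J : Set ℝ} (hJ : J.OrdConnected) {f : ℝ → ℝ}
    (hf : ∀ v ∈ J, HasDerivAt f 0 v) {u v : ℝ} (hu : u ∈ J) (hv : v ∈ J) : f u = f v := by
  have := hJ.convex.norm_image_sub_le_of_norm_hasDerivWithin_le (f := f) (f' := fun _ => 0)
    (C := 0) (fun v hv => (hf v hv).hasDerivWithinAt) (by simp) hv hu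
  simpa [sub_eq_zero] using this

/-- On an interval, a `C¹` function `B` with `B = 0` or `B' = k ≠ 0` at each point either has
constant derivative `k` or is zero. -/
theorem deriv_eq_or_eq_zero {J : Set ℝ} (hJ : J.OrdConnected) (hJn : J.Nontrivial) {B : ℝ → ℝ}
    (hB : ContDiff ℝ 1 B) {k : ℝ} (hk : k ≠ 0) (h : ∀ v ∈ J, B v = 0 ∨ deriv B v = k) :
    (∀ v ∈ J, deriv B v = k) ∨ ∀ v ∈ J, B v = 0 := by
  have hB' : Continuous (deriv B) := hB.continuous_deriv le_rfl
  have hd : ∀ v, HasDerivAt B (deriv B v) v := fun v =>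
    (hB.differentiable one_ne_zero v).hasDerivAt
  have hval : ∀ v ∈ J, deriv B v = 0 ∨ deriv B v = k := by
    intro v hv
    rcases h v hv with h0 | h0
    swap
    · exact Or.inr h0
    by_cases hv0 : deriv B v = 0
    · exact Or.inl hv0
    right
    -- A zero of B with nonzero derivative is isolated, so B' = k at nearby points of J and, by
    -- continuity, at v. Hence B' takes only the values 0 and k on J.
    have hne : ∀ᶠ u in nhdsWithin v {v}ᶜ, B u ≠ 0 := (hd v).eventually_ne hv0
    have hacc : (nhdsWithin v {v}ᶜ ⊓ Filter.principal J).NeBot :=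
      (uniqueDiffOn_of_ordConnected hJ hJn v hv).accPt
    have hev : ∀ᶠ u in nhdsWithin v {v}ᶜ ⊓ Filter.principal J, deriv B u = k := by
      filter_upwards [Filter.mem_inf_of_left hne,
        Filter.mem_inf_of_right (Filter.mem_principal_self J)] with u hu1 hu2
      exact (h u hu2).resolve_left hu1
    exact tendsto_nhds_unique
      ((hB'.tendsto v).mono_left (inf_le_left.trans nhdsWithin_le_nhds))
      (tendsto_const_nhds.congr' (hev.mono fun u hu => hu.symm))
  by_cases hall : ∀ v ∈ J, deriv B v = k
  · exact Or.inl hall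
  right
  push Not at hall
  obtain ⟨v, hv, hvk⟩ := hall
  have hv0 := (hval v hv).resolve_right hvk
  intro u hu
  refine (h u hu).resolve_right fun huk => ?_
  have hJ' : (deriv B '' J).OrdConnected :=
    (hJ.isPreconnected.image _ hB'.continuousOn).ordConnected
  -- Were both 0 and k attained, the intermediate value theorem would force the excluded value k/2.
  have hmem : k / 2 ∈ deriv B '' J := by
    refine hJ'.uIcc_subset ⟨v, hv, rfl⟩ ⟨u, hu, rfl⟩ ?_
    rw [hv0, huk, Set.mem_uIcc]
    rcases le_total 0 k with h | h
    · left; constructor <;> linarith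
    · right; constructor <;> linarith
  obtain ⟨z, hz, hzk⟩ := hmem
  rcases hval z hz with h | h
  · exact hk (by linarith)
  · exact hk (by linarith)

namespace StaticFluid

variable {n : ℕ} {X : StaticFluid n} {G : ℝ} {Ω : Set (Fin n → ℝ)} {y : Fin n → ℝ} {φ₀ : ℝ}
  {w : ℝ → ℝ} {lam χ ε b : ℝ}

/-- The two forms of the constraint agree. -/
theorem fluidConstraint_iff (hlam : 1 + lam ≠ 0) :
    X.FluidConstraint G Ω lam ε b ↔ X.FluidConstraint' G Ω lam ε b := by
  refine forall_congr' fun y => forall_congr' fun _ => ?_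
  generalize X.ρm y + (n : ℝ) / ((n : ℝ) - 2) * X.p y = m
  constructor
  · intro h
    field_simp at h ⊢
    linear_combination h
  · intro h
    field_simp at h ⊢
    linear_combination h

theorem contDiff_mul_deriv (hw : ContDiff ℝ 2 w) : ContDiff ℝ 1 fun v => w v * deriv w v :=
  (hw.of_le (by norm_num)).mul (ContDiff.deriv' (n := 1) hw)

theorem hasDerivAt_sq (hw : ContDiff ℝ 2 w) (v : ℝ) :
    HasDerivAt (fun v => w v ^ 2) (2 * (w v * deriv w v)) v := by
  have := (hw.differentiable two_ne_zero v).hasDerivAt.fun_pow 2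
  exact this.congr_deriv (by push_cast; ring)

namespace IsEinsteinMaxwell

/-- The Einstein equations for a fluid of Weyl type. -/
theorem weyl_equation (hn : 3 ≤ n) (hX : X.IsEinsteinMaxwell G Ω) (hΩ : IsOpen Ω)
    (hw : ContDiff ℝ 2 w) (hWeyl : ∀ y ∈ Ω, X.W y = w (X.φ y)) (hy : y ∈ Ω) :
    deriv (fun v => w v * deriv w v) (X.φ y) * X.ρem y = deriv w (X.φ y) * X.ρe y
      + G * (X.ρm y + (n : ℝ) / ((n : ℝ) - 2) * X.p y + X.ρem y) := by
  have hW := (hX.W_pos y hy).ne'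
  have hS := (sphereArea_pos (n := n) (by omega)).ne'
  have h1 := hX.laplacian_W hn hΩ hy
  have hB := contDiff_mul_deriv hw
  -- Here ∇W = w'(φ) ∇φ is written as w w' · ∇φ/W, the form to which Gauss' law applies.
  rw [divergence_congr (V' := fun i z => w (X.φ z) * deriv w (X.φ z) *
      (gradient X.h X.φ i z / X.W z)) hΩ hy fun z hz i => ?_] at h1
  · rw [hX.divergence_comp hn hΩ hy (A := fun v => w v * deriv w v)
      (hB.differentiable one_ne_zero _)] at h1
    rw [← hWeyl y hy] at h1
    apply mul_left_cancel₀ (mul_ne_zero hS hW)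
    linear_combination h1
  · have hz' := (hX.W_pos z hz).ne'
    have : ∀ j, pd j X.W z = deriv w (X.φ z) * pd j X.φ z := fun j => by
      rw [pd_congr j hΩ hz hWeyl,
        pd_comp j (hw.differentiable two_ne_zero _) (hX.diff_φ hΩ hz)]
    rw [← hWeyl z hz, gradient, gradient]
    simp only [this]
    field_simp
    rw [Finset.mul_sum]
    exact Finset.sum_congr rfl fun j _ => by ring

/-- The charge density vanishes where the potential is locally constant. -/
theorem ρe_eq_zero (hn : 3 ≤ n) (hX : X.IsEinsteinMaxwell G Ω) (hΩ : IsOpen Ω) (hy : y ∈ Ω)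
    (h : ∀ᶠ z in nhds y, X.ρem z = 0) : X.ρe y = 0 := by
  have hS := (sphereArea_pos (n := n) (by omega)).ne'
  obtain ⟨U, hU, hUo, hyU⟩ := mem_nhds_iff.mp (h.and (hΩ.mem_nhds hy))
  have h1 := hX.divergence_gradient_φ hΩ hy
  rw [divergence_congr (V' := fun _ _ => 0) hUo hyU fun z hz i => by
    have := (hX.ρem_eq_zero_iff hn (hU hz).2).mp (hU hz).1
    simp [gradient, this]] at h1
  have h2 : divergence X.h (fun _ _ => 0) y = 0 := by
    simp [divergence, pd_const]
  rw [h2] at h1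
  simpa [hS] using h1.symm

/-- Hydrostatic equilibrium combined with the pressure condition. -/
theorem pressure_equation (hn : 3 ≤ n) (hG : 0 < G) (hX : X.IsEinsteinMaxwell G Ω)
    (hΩ : IsOpen Ω) (hw : ContDiff ℝ 2 w) (hWeyl : ∀ y ∈ Ω, X.W y = w (X.φ y))
    (hP : X.PressureCondition Ω w lam χ) (hy : y ∈ Ω) (hne : X.ρem y ≠ 0) :
    (X.W y ^ 2 + χ) * X.ρe y + X.W y ^ 2 * deriv w (X.φ y) *
      ((1 + lam) * (X.ρm y + (n : ℝ) / ((n : ℝ) - 2) * X.p y) + lam * X.ρem y) = 0 := by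
  obtain ⟨P, hPd, hpP, hPe⟩ := hP
  have hW := (hX.W_pos y hy).ne'
  have hn' : (3 : ℝ) ≤ n := by exact_mod_cast hn
  have hn2 : (n : ℝ) - 2 ≠ 0 := by linarith
  -- Equilibrium is a multiple of ∂_j φ once p and W are functions of φ; a nonzero component is
  -- needed in order to divide by it.
  have hj : ∃ j, pd j X.φ y ≠ 0 := by
    by_contra hcon
    push Not at hcon
    exact hne ((hX.ρem_eq_zero_iff hn hy).mpr hcon)
  obtain ⟨j, hj⟩ := hj
  have he := hX.euler hn hG hΩ hy j
  rw [pd_congr j hΩ hy hpP, pd_comp j (hPd _) (hX.diff_φ hΩ hy), pd_congr j hΩ hy hWeyl,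
    pd_comp j (hw.differentiable two_ne_zero _) (hX.diff_φ hΩ hy)] at he
  have he' : X.W y * deriv P (X.φ y) + (X.ρm y + X.p y) * deriv w (X.φ y) + X.ρe y = 0 := by
    apply mul_left_cancel₀ hj
    linear_combination he
  have hp := hPe y hy
  -- The first summand is the p of the equilibrium equation, the second the correction on the left
  -- of the pressure condition.
  have h1 : (n : ℝ) / ((n : ℝ) - 2) * X.p y = X.p y + 2 / ((n : ℝ) - 2) * X.p y := by
    field_simp; ring
  have h2 : (deriv P (X.φ y) - 2 / ((n : ℝ) - 2) * (deriv w (X.φ y) / X.W y) * X.p y) * X.W y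
      = -(deriv w (X.φ y) * (X.ρm y + (n : ℝ) / ((n : ℝ) - 2) * X.p y)) - X.ρe y := by
    rw [h1]
    have : deriv w (X.φ y) / X.W y * X.W y = deriv w (X.φ y) := by field_simp
    linear_combination he' - 2 / ((n : ℝ) - 2) * X.p y * this
  rw [h2] at hp
  generalize X.ρm y + (n : ℝ) / ((n : ℝ) - 2) * X.p y = m at hp ⊢
  field_simp at hp
  linear_combination -hp

/-- The first integral of the Weyl equation under the pressure condition. -/
theorem first_integral (hn : 3 ≤ n) (hG : 0 < G) (hX : X.IsEinsteinMaxwell G Ω)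
    (hΩ : IsOpen Ω) (hconn : IsConnected Ω) (hbdd : Bornology.IsBounded Ω)
    (hφ : ContinuousOn X.φ (closure Ω)) (hbdry : ∀ y ∈ frontier Ω, X.φ y = φ₀)
    (hw : ContDiff ℝ 2 w) (hWeyl : ∀ y ∈ Ω, X.W y = w (X.φ y)) (hnt : (X.φ '' Ω).Nontrivial)
    (hP : X.PressureCondition Ω w lam χ) :
    ∀ v ∈ X.φ '' Ω, (1 + lam) * (w v * deriv w v) ^ 2 = G * (w v ^ 2 + χ) := by
  have hB := contDiff_mul_deriv hw
  set B : ℝ → ℝ := fun v => w v * deriv w v with hBdef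
  -- Eliminating m between `weyl_equation` and `pressure_equation` leaves W Q' ρ_em = 2 Q ρ_e for
  -- this Q.
  set Q : ℝ → ℝ := fun v => (1 + lam) * B v ^ 2 - G * (w v ^ 2 + χ) with hQdef
  have hQ : ContDiff ℝ 1 Q :=
    (contDiff_const.mul (hB.pow 2)).sub
      (contDiff_const.mul (((hw.of_le (by norm_num)).pow 2).add contDiff_const))
  have hQ' : ∀ v, deriv Q v = 2 * B v * ((1 + lam) * deriv B v - G) := by
    intro v
    have h1 := ((hB.differentiable one_ne_zero v).hasDerivAt.fun_pow 2).const_mul (1 + lam)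
    have h2 := ((hasDerivAt_sq hw v).add_const χ).const_mul G
    rw [(h1.fun_sub h2).deriv]
    simp only [hBdef]; push_cast; ring
  have hne : ∀ z ∈ Ω, X.ρem z ≠ 0 →
      X.W z * deriv Q (X.φ z) * X.ρem z = 2 * Q (X.φ z) * X.ρe z := by
    intro z hz hzne
    have h1 := hX.weyl_equation hn hΩ hw hWeyl hz
    have h2 := hX.pressure_equation hn hG hΩ hw hWeyl hP hz hzne
    rw [hQ']
    change deriv B (X.φ z) * _ = _ at h1
    simp only [hQdef]
    have h3 : B (X.φ z) = X.W z * deriv w (X.φ z) := by rw [hWeyl z hz]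
    rw [h3, ← hWeyl z hz]
    generalize X.ρm z + (n : ℝ) / ((n : ℝ) - 2) * X.p z = m at h1 h2
    linear_combination 2 * X.W z ^ 2 * deriv w (X.φ z) * (1 + lam) * h1 + 2 * G * h2
  have hall : ∀ z ∈ Ω, X.W z * deriv Q (X.φ z) * X.ρem z = 2 * Q (X.φ z) * X.ρe z := by
    intro z hz
    -- If ρ_em vanishes near z, Gauss' law gives ρ_e = 0 and both sides are zero. Otherwise z is a
    -- limit of points with ρ_em ≠ 0, and continuity applies.
    by_cases hloc : ∀ᶠ u in nhds z, X.ρem u = 0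
    · rw [hX.ρe_eq_zero hn hΩ hz hloc, hloc.self_of_nhds]; ring
    · by_contra hcon
      have hφΩ : ContinuousOn X.φ Ω := hφ.mono subset_closure
      have hcont : ContinuousOn (fun z => X.W z * deriv Q (X.φ z) * X.ρem z
          - 2 * Q (X.φ z) * X.ρe z) Ω :=
        ((hX.smooth_W.continuousOn.mul ((hQ.continuous_deriv le_rfl).comp_continuousOn hφΩ)).mul
          (hX.contDiffOn_ρem hΩ).continuousOn).sub
          ((continuousOn_const.mul (hQ.continuous.comp_continuousOn hφΩ)).mul
            hX.smooth_ρe.continuousOn)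
      have hev := (hcont.continuousAt (hΩ.mem_nhds hz)).eventually_ne (sub_ne_zero.mpr hcon)
      apply hloc
      filter_upwards [hev, hΩ.mem_nhds hz] with u hu huΩ
      by_contra hune
      exact hu (sub_eq_zero.mpr (hne u huΩ hune))
  exact fun v hv => sub_eq_zero.mp
    (hX.eq_zero_of_divergence_free hn hΩ hconn hbdd hφ hbdry hnt hQ hall v hv)

/-- The pressure condition forces the Weyl relation and the constraint. -/
theorem weylRelation_of_pressureCondition (hn : 3 ≤ n) (hG : 0 < G)
    (hX : X.IsEinsteinMaxwell G Ω)
    (hΩ : IsOpen Ω) (hconn : IsConnected Ω) (hbdd : Bornology.IsBounded Ω)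
    (hφ : ContinuousOn X.φ (closure Ω)) (hbdry : ∀ y ∈ frontier Ω, X.φ y = φ₀)
    (hw : ContDiff ℝ 2 w) (hWeyl : ∀ y ∈ Ω, X.W y = w (X.φ y)) (hnt : (X.φ '' Ω).Nontrivial)
    (hnc : ¬ ∃ c : ℝ, ∀ y ∈ Ω, X.W y = c) (hP : X.PressureCondition Ω w lam χ) :
    1 + lam ≠ 0 ∧ ∀ ε : ℝ, (ε = 1 ∨ ε = -1) →
      ∃ b : ℝ, X.WeylRelation G Ω lam χ ε b ∧ X.FluidConstraint' G Ω lam ε b := by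
  have hfi := hX.first_integral hn hG hΩ hconn hbdd hφ hbdry hw hWeyl hnt hP
  have hJ : (X.φ '' Ω).OrdConnected :=
    (hconn.isPreconnected.image _ (hφ.mono subset_closure)).ordConnected
  have hWsq : ¬ ∃ c : ℝ, ∀ v ∈ X.φ '' Ω, w v ^ 2 = c := by
    rintro ⟨c, hc⟩
    refine hnc ⟨√c, fun y hy => ?_⟩
    rw [← hc _ ⟨y, hy, rfl⟩, ← hWeyl y hy, Real.sqrt_sq (hX.W_pos y hy).le]
  -- Otherwise the first integral reads w² = -χ, and the positive function W would be constant.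
  have hlam : 1 + lam ≠ 0 := by
    intro h0
    refine hWsq ⟨-χ, fun v hv => ?_⟩
    have := hfi v hv
    rw [h0, zero_mul] at this
    have := (mul_eq_zero.mp this.symm).resolve_left hG.ne'
    linarith
  refine ⟨hlam, fun ε hε => ?_⟩
  have hε2 : ε ^ 2 = 1 := by rcases hε with h | h <;> simp [h]
  have hB := contDiff_mul_deriv hw
  have hweyl := fun y hy => hX.weyl_equation hn hΩ hw hWeyl (y := y) hy
  set B : ℝ → ℝ := fun v => w v * deriv w v with hBdef
  have hBd : ∀ v, HasDerivAt B (deriv B v) v := fun v =>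
    (hB.differentiable one_ne_zero v).hasDerivAt
  -- Differentiating the first integral gives 2 (1+λ) B B' = 2 G B.
  have hdich : ∀ v ∈ X.φ '' Ω, B v = 0 ∨ deriv B v = G / (1 + lam) := by
    intro v hv
    have h1 := hasDerivAt_unique_of_eqOn hJ hnt hv (f := fun v => (1 + lam) * B v ^ 2)
      (g := fun v => G * (w v ^ 2 + χ)) (fun u hu => hfi u hu)
      (((hBd v).fun_pow 2).const_mul (1 + lam))
      (((hasDerivAt_sq hw v).add_const χ).const_mul G)
    by_cases hv0 : B v = 0
    · exact Or.inl hv0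
    · right
      rw [eq_div_iff hlam]
      apply mul_left_cancel₀ hv0
      have h2 : w v * deriv w v = B v := rfl
      rw [h2] at h1
      norm_num at h1
      linear_combination h1 / 2
  have hk : G / (1 + lam) ≠ 0 := div_ne_zero hG.ne' hlam
  rcases deriv_eq_or_eq_zero hJ hnt hB hk hdich with hlin | hzero
  swap
  · exfalso
    obtain ⟨v₀, hv₀, -⟩ := hnt
    refine hWsq ⟨w v₀ ^ 2, fun v hv =>
      eq_of_hasDerivAt_zero (f := fun v => w v ^ 2) hJ (fun u hu => ?_) hv hv₀⟩
    have := hasDerivAt_sq hw u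
    rwa [show w u * deriv w u = 0 from hzero u hu, mul_zero] at this
  obtain ⟨v₀, hv₀, -⟩ := hnt
  have hsG : √G ≠ 0 := (Real.sqrt_pos.mpr hG).ne'
  have hsG2 : √G ^ 2 = G := Real.sq_sqrt hG.le
  set c := G / (1 + lam) * v₀ - B v₀ with hc
  have hBlin : ∀ v ∈ X.φ '' Ω, B v = G / (1 + lam) * v - c := by
    intro v hv
    have := eq_of_hasDerivAt_zero hJ (f := fun v => B v - G / (1 + lam) * v) (fun u hu => by
      have := (hBd u).fun_sub ((hasDerivAt_id u).const_mul (G / (1 + lam)))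
      rw [hlin u hu] at this
      simpa using this) hv hv₀
    rw [hc]; linarith
  -- This fixes b: it makes -ε√G φ + b equal to -ε (1+λ) B/√G, where -c is the intercept of the
  -- affine function B. Squaring then recovers the first integral for either sign ε.
  have hf : ∀ y ∈ Ω, √G * (-ε * √G * X.φ y + ε * (1 + lam) * c / √G)
      = -ε * (1 + lam) * B (X.φ y) := by
    intro y hy
    rw [hBlin _ ⟨y, hy, rfl⟩]
    field_simp
    rw [hsG2]; ring
  refine ⟨ε * (1 + lam) * c / √G, fun y hy => ?_, fun y hy => ?_⟩
  · have h1 := hf y hy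
    have h2 := hfi _ ⟨y, hy, rfl⟩
    change (1 + lam) * B (X.φ y) ^ 2 = _ at h2
    rw [← hWeyl y hy] at h2
    generalize -ε * √G * X.φ y + ε * (1 + lam) * c / √G = f at h1 ⊢
    have h3 : G * f ^ 2 = G * ((1 + lam) * (X.W y ^ 2 + χ)) := by
      calc G * f ^ 2 = (√G * f) ^ 2 := by rw [mul_pow, hsG2]
        _ = ε ^ 2 * (1 + lam) * ((1 + lam) * B (X.φ y) ^ 2) := by rw [h1]; ring
        _ = _ := by rw [h2, hε2]; ring
    have h4 := mul_left_cancel₀ hG.ne' h3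
    rw [h4]
    field_simp
    ring
  · have h1 := hf y hy
    have h2 := hweyl y hy
    rw [hlin _ ⟨y, hy, rfl⟩] at h2
    have h3 : B (X.φ y) = X.W y * deriv w (X.φ y) := by rw [hWeyl y hy]
    rw [h3] at h1
    generalize -ε * √G * X.φ y + ε * (1 + lam) * c / √G = f at h1 ⊢
    generalize X.ρm y + (n : ℝ) / ((n : ℝ) - 2) * X.p y = m at h2 ⊢
    field_simp at h2 ⊢
    apply mul_left_cancel₀ hsG
    linear_combination X.ρe y * h1 + ε * X.W y * h2
      - ε * ((1 + lam) * m + lam * X.ρem y) * X.W y * hsG2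

/-- The constraint forces a Weyl relation. -/
theorem weylRelation_of_fluidConstraint (hn : 3 ≤ n) (hG : 0 < G)
    (hX : X.IsEinsteinMaxwell G Ω)
    (hΩ : IsOpen Ω) (hconn : IsConnected Ω) (hbdd : Bornology.IsBounded Ω)
    (hφ : ContinuousOn X.φ (closure Ω)) (hbdry : ∀ y ∈ frontier Ω, X.φ y = φ₀)
    (hw : ContDiff ℝ 2 w) (hWeyl : ∀ y ∈ Ω, X.W y = w (X.φ y)) (hnt : (X.φ '' Ω).Nontrivial)
    (hlam : 1 + lam ≠ 0) (hε : ε = 1 ∨ ε = -1) (hC : X.FluidConstraint' G Ω lam ε b) :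
    ∃ χ' : ℝ, X.WeylRelation G Ω lam χ' ε b := by
  have hJ : (X.φ '' Ω).OrdConnected :=
    (hconn.isPreconnected.image _ (hφ.mono subset_closure)).ordConnected
  have hε2 : ε ^ 2 = 1 := by rcases hε with h | h <;> simp [h]
  have hsG2 : √G ^ 2 = G := Real.sq_sqrt hG.le
  have hB := contDiff_mul_deriv hw
  have hweyl := fun y hy => hX.weyl_equation hn hΩ hw hWeyl (y := y) hy
  set B : ℝ → ℝ := fun v => w v * deriv w v with hBdef
  -- Half the derivative of w² - (-ε√G v + b)²/(1+λ); the relation sought is Y = 0.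
  set Y : ℝ → ℝ := fun v => B v + ε * √G / (1 + lam) * (-ε * √G * v + b) with hYdef
  have hY : ContDiff ℝ 1 Y := hB.add (by fun_prop)
  have hf : ∀ v : ℝ, HasDerivAt (fun v => -ε * √G * v + b) (-ε * √G) v := fun v => by
    simpa using ((hasDerivAt_id v).const_mul (-ε * √G)).add_const b
  have hYd : ∀ v, deriv Y v = deriv B v - G / (1 + lam) := by
    intro v
    have h1 := (hB.differentiable one_ne_zero v).hasDerivAt.fun_add
      ((hf v).const_mul (ε * √G / (1 + lam)))
    rw [h1.deriv]
    have : ε * √G / (1 + lam) * (-ε * √G) = -(ε ^ 2 * √G ^ 2 / (1 + lam)) := by ring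
    rw [this, hε2, hsG2]; ring
  have hYe : ∀ z ∈ Ω, X.W z * deriv Y (X.φ z) * X.ρem z = Y (X.φ z) * X.ρe z := by
    intro z hz
    have h1 := hweyl z hz
    have h2 := hC z hz
    have h3 : B (X.φ z) = X.W z * deriv w (X.φ z) := by rw [hWeyl z hz]
    rw [hYd]
    simp only [hYdef]
    rw [h3]
    generalize -ε * √G * X.φ z + b = f at h2 ⊢
    generalize X.ρm z + (n : ℝ) / ((n : ℝ) - 2) * X.p z = m at h1 h2
    field_simp at h2 ⊢
    linear_combination X.W z * (1 + lam) * h1 - ε * √G * h2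
      - X.W z * (m * (1 + lam) + lam * X.ρem z) * (√G ^ 2 * hε2 + hsG2)
  -- Multiplying W Y' ρ_em = Y ρ_e by 2Y gives the required equation for Q = Y².
  have hzero := hX.eq_zero_of_divergence_free hn hΩ hconn hbdd hφ hbdry hnt
    (Q := fun v => Y v ^ 2) (hY.pow 2) (fun z hz => by
      have hd : deriv (fun v => Y v ^ 2) (X.φ z) = 2 * Y (X.φ z) * deriv Y (X.φ z) := by
        rw [((hY.differentiable one_ne_zero (X.φ z)).hasDerivAt.fun_pow 2).deriv]
        norm_num
      rw [hd]
      linear_combination 2 * Y (X.φ z) * hYe z hz)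
  have hconst : ∀ v ∈ X.φ '' Ω,
      HasDerivAt (fun v => w v ^ 2 - 1 / (1 + lam) * (-ε * √G * v + b) ^ 2) 0 v := by
    intro v hv
    have h1 := (hasDerivAt_sq hw v).fun_sub (((hf v).fun_pow 2).const_mul (1 / (1 + lam)))
    have h2 : Y v = 0 := pow_eq_zero_iff two_ne_zero |>.mp (hzero v hv)
    simp only [hYdef, hBdef] at h2
    refine h1.congr_deriv ?_
    push_cast
    linear_combination 2 * h2
  obtain ⟨v₀, hv₀, -⟩ := hnt
  refine ⟨-(w v₀ ^ 2 - 1 / (1 + lam) * (-ε * √G * v₀ + b) ^ 2), fun y hy => ?_⟩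
  have := eq_of_hasDerivAt_zero hJ hconst ⟨y, hy, rfl⟩ hv₀
  rw [hWeyl y hy]
  linarith

end IsEinsteinMaxwell

/-- The constant `b` in a Weyl relation is unique. -/
theorem WeylRelation.const_unique (hG : 0 < G) (hnt : (X.φ '' Ω).Nontrivial)
    (hlam : 1 + lam ≠ 0) (hε : ε ≠ 0) {χ' b' : ℝ} (h : X.WeylRelation G Ω lam χ ε b)
    (h' : X.WeylRelation G Ω lam χ' ε b') : b = b' := by
  obtain ⟨_, ⟨y, hy, rfl⟩, _, ⟨z, hz, rfl⟩, hyz⟩ := hnt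
  have hsG : √G ≠ 0 := (Real.sqrt_pos.mpr hG).ne'
  have e1 := h y hy
  have e2 := h' y hy
  have e3 := h z hz
  have e4 := h' z hz
  -- Subtracting the two relations leaves an affine function of φ with slope proportional to b - b'.
  -- Comparing two points with different potential removes both constants χ and χ'.
  have h1 : 1 / (1 + lam) * ((-ε * √G * X.φ y + b) ^ 2 - (-ε * √G * X.φ y + b') ^ 2
      - ((-ε * √G * X.φ z + b) ^ 2 - (-ε * √G * X.φ z + b') ^ 2)) = 0 := by
    linear_combination e2 - e1 + e3 - e4
  have h2 := (mul_eq_zero.mp h1).resolve_left (one_div_ne_zero hlam)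
  have h3 : (ε * √G * (X.φ y - X.φ z)) * (b - b') = 0 := by
    linear_combination (-1 / 2) * h2
  exact sub_eq_zero.mp ((mul_eq_zero.mp h3).resolve_left
    (mul_ne_zero (mul_ne_zero hε hsG) (sub_ne_zero.mpr hyz)))

end StaticFluid

end EMFluid

end

/-! ### The main theorem. -/

theorem mainTheorem2 (n : ℕ) (hn : 3 ≤ n) (G : ℝ) (hG : 0 < G)
    (Ω : Set (Fin n → ℝ)) (hΩ_open : IsOpen Ω) (hΩ_conn : IsConnected Ω)
    (hΩ_bdd : Bornology.IsBounded Ω)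
    (X : EMFluid.StaticFluid n) (hX : X.IsEinsteinMaxwell G Ω)
    (hφ_cont : ContinuousOn X.φ (closure Ω))
    (φ₀ : ℝ) (hφ_bdry : ∀ y ∈ frontier Ω, X.φ y = φ₀)
    (w : ℝ → ℝ) (hw : ContDiff ℝ 2 w) (hWeyl : ∀ y ∈ Ω, X.W y = w (X.φ y))
    (hW_nonconst : ¬ ∃ c : ℝ, ∀ y ∈ Ω, X.W y = c)
    (lam χ : ℝ) :
    (X.PressureCondition Ω w lam χ →
      1 + lam ≠ 0 ∧
      ∀ ε : ℝ, (ε = 1 ∨ ε = -1) →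
        ∃ b : ℝ, X.WeylRelation G Ω lam χ ε b ∧
          X.FluidConstraint G Ω lam ε b ∧ X.FluidConstraint' G Ω lam ε b) ∧
    (1 + lam ≠ 0 →
      ∀ ε b : ℝ, (ε = 1 ∨ ε = -1) → X.FluidConstraint G Ω lam ε b →
        (∃ χ' : ℝ, X.WeylRelation G Ω lam χ' ε b) ∧
        (X.PressureCondition Ω w lam χ → X.WeylRelation G Ω lam χ ε b)) := by
  -- A constant potential would make W = w(φ) constant.
  have hnt : (X.φ '' Ω).Nontrivial := by
    rw [← Set.not_subsingleton_iff]
    intro hsub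
    obtain ⟨y₀, hy₀⟩ := hΩ_conn.nonempty
    refine hW_nonconst ⟨X.W y₀, fun y hy => ?_⟩
    rw [hWeyl y hy, hWeyl y₀ hy₀, hsub ⟨y, hy, rfl⟩ ⟨y₀, hy₀, rfl⟩]
  have hi := hX.weylRelation_of_pressureCondition hn hG hΩ_open hΩ_conn hΩ_bdd hφ_cont hφ_bdry hw
    hWeyl hnt hW_nonconst (lam := lam) (χ := χ)
  refine ⟨fun hP => ?_, fun hlam ε b hε hC => ?_⟩
  · obtain ⟨hlam, hb⟩ := hi hP
    refine ⟨hlam, fun ε hε => ?_⟩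
    obtain ⟨b, hb1, hb2⟩ := hb ε hε
    exact ⟨b, hb1, (EMFluid.StaticFluid.fluidConstraint_iff hlam).mpr hb2, hb2⟩
  · have hex := hX.weylRelation_of_fluidConstraint hn hG hΩ_open hΩ_conn hΩ_bdd hφ_cont hφ_bdry hw
      hWeyl hnt hlam hε ((EMFluid.StaticFluid.fluidConstraint_iff hlam).mp hC)
    refine ⟨hex, fun hP => ?_⟩
    obtain ⟨χ', hχ'⟩ := hex
    obtain ⟨b', hb', -⟩ := (hi hP).2 ε hε
    have hε0 : ε ≠ 0 := by rcases hε with h | h <;> simp [h]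
    -- Part (i) gives the relation with the prescribed χ but its own b'; uniqueness identifies b'
    -- with the given b.
    rwa [hb'.const_unique hG hnt hlam hε0 hχ'] at hb'
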